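/- Let $n\ge 1$, let $\langle z,w\rangle=\sum_j z_j\bar w_j$ on $\mathbb C^n$, and let $\mathscr L(\mathbb C^n)_+$ be the set of positive definite Hermitian $n\times n$ matrices, with the distance $\mathrm{dist}$ given by the Hilbert–Schmidt norm. For $z\ne0$ let $\Pi_z$ be the orthogonal projector of $\mathbb C^n$ onto the line $\mathbb C z$. Let $\nu$ be a non-zero finite Borel measure on $\mathbb{C}P^{n-1}$, put $|\nu|=\nu(\mathbb{C}P^{n-1})$, and define Donaldson's map $T_\nu:\mathscr L(\mathbb C^n)_+\to\mathscr L(\mathbb C^n)_+$ by $$T_\nu(G)=\frac{n}{|\nu|}\int_{\mathbb{C}P^{n-1}}\Pi_z\,\frac{|z|^2}{\langle G^{-1}z,z\rangle}\,d\nu([z]).$$ Suppose that $\nu$ is supported on a closed complex variety $Y\subset\mathbb{C}P^{n-1}$ and is absolutely continuous on every irreducible component $Z$ of $Y$ (that is, $\nu$ vanishes on the Borel subsets of $Z$ of zero $2\dim_{\mathbb C}Z$-dimensional volume). Assume moreover that (i) for every non-empty proper projective subspace $\Sigma\subset\mathbb{C}P^{n-1}$, $$\frac{\nu(\Sigma)}{\dim\Sigma+1}<\frac{|\nu|}{n};$$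 (ii) at least one irreducible component of $Y$ is not contained in any proper projective subspace of $\mathbb{C}P^{n-1}$. Then for every $G_0\in\mathscr L(\mathbb C^n)_+$ all the iterates $T_\nu^r(G_0)$ are well defined in $\mathscr L(\mathbb C^n)_+$, and there exist a fixed point $G_\infty\in\mathscr L(\mathbb C^n)_+$ of $T_\nu$ and constants $C>0$ and $\beta\in(0,1)$ such that $$\mathrm{dist}\big(T_\nu^r(G_0),G_\infty\big)\le C\beta^r\qquad\text{for all } r\in\mathbb N.$$ -/

import Mathlib

open MeasureTheory
open scoped LinearAlgebra.Projectivization Matrix Matrix.Norms.Frobenius ComplexOrder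

noncomputable section

namespace Donaldson

/-- The complex projective space `ℂP^{n-1}` of lines in `ℂ^n`. -/
abbrev CProj (n : ℕ) : Type := ℙ ℂ (Fin n → ℂ)

/-- The classical topology on `ℂP^{n-1}`: the quotient topology from `ℂ^n ∖ {0}`. -/
instance instTopologicalSpaceCProj (n : ℕ) : TopologicalSpace (CProj n) :=
  inferInstanceAs
    (TopologicalSpace (Quotient (projectivizationSetoid ℂ (Fin n → ℂ))))

/-- The Borel `σ`-algebra of the classical topology. -/
instance instMeasurableSpaceCProj (n : ℕ) : MeasurableSpace (CProj n) := borel (CProj n)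

instance instBorelSpaceCProj (n : ℕ) : BorelSpace (CProj n) := ⟨rfl⟩

/-! ### Complex projective varieties -/

/-- The Zariski topology on `ℂP^{n-1}`: its closed sets are the common zero loci of families of
homogeneous polynomials. (The nonvanishing loci of homogeneous polynomials are stable under finite
intersections, so they form a basis.) -/
@[reducible] def zariski (n : ℕ) : TopologicalSpace (CProj n) :=
  TopologicalSpace.generateFrom
    {U | ∃ (f : MvPolynomial (Fin n) ℂ) (d : ℕ), f.IsHomogeneous d ∧
      U = {x : CProj n | MvPolynomial.eval x.rep f ≠ 0}}

/-- `Y` is a (closed, possibly reducible) complex variety in `ℂP^{n-1}`. -/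
def IsVariety {n : ℕ} (Y : Set (CProj n)) : Prop := @IsClosed _ (zariski n) Y

/-- `Z` is an irreducible component of `Y`: a maximal (Zariski) irreducible subset. -/
def IsComponent {n : ℕ} (Y Z : Set (CProj n)) : Prop :=
  Maximal (fun S : Set (CProj n) => S ⊆ Y ∧ @IsIrreducible _ (zariski n) S) Z

/-- The complex dimension of `Z ⊆ ℂP^{n-1}`: the Krull dimension for the Zariski topology. -/
def varietyDim {n : ℕ} (Z : Set (CProj n)) : WithBot ℕ∞ :=
  @topologicalKrullDim Z ((zariski n).induced Subtype.val)

/-! ### Rank one projectors -/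

/-- The Hermitian product `⟨z, w⟩ = ∑ j, z j * conj (w j)` on `ℂ^n`. -/
def herm {n : ℕ} (z w : Fin n → ℂ) : ℂ := ∑ j, z j * star (w j)

/-- The orthogonal projector `Π_z` of `ℂ^n` onto the line spanned by `z ≠ 0`:
its matrix entries are `z i * conj (z j) / |z|²`. -/
def lineProj {n : ℕ} (z : Fin n → ℂ) : Matrix (Fin n) (Fin n) ℂ :=
  Matrix.of fun i j => z i * star (z j) / herm z z

/-- The embedding `[z] ↦ Π_z` of `ℂP^{n-1}` in the Euclidean space of `n × n` matrices with the
Hilbert-Schmidt norm. It induces a multiple of the Fubini-Study metric. -/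
def projEmb {n : ℕ} (x : CProj n) : EuclideanSpace ℂ (Fin n × Fin n) :=
  WithLp.toLp 2 fun p => lineProj x.rep p.1 p.2

/-- `ν` is absolutely continuous on the irreducible variety `Z` of complex dimension `d`: it does
not charge the subsets of `Z` of zero `2d`-dimensional volume. The volume of `Z` is taken as the
`2d`-dimensional Hausdorff measure, which up to a constant is the Riemannian volume on the smooth
part of `Z` and which vanishes on the singular part. -/
def AbsContOn {n : ℕ} (ν : Measure (CProj n)) (Z : Set (CProj n)) : Prop :=
  ∃ d : ℕ, varietyDim Z = d ∧
    ∀ N : Set (CProj n), N ⊆ Z → MeasurableSet N →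
      Measure.hausdorffMeasure (2 * d : ℝ) (projEmb '' N) = 0 → ν N = 0

/-! ### Donaldson's map -/

/-- Donaldson's map
`T_ν(G) = (n / |ν|) ∫ Π_z |z|² / ⟨G⁻¹ z, z⟩ dν([z])`;
the integrand does not depend on the representative `z` of the point `[z]`. -/
def T {n : ℕ} (ν : Measure (CProj n)) (G : Matrix (Fin n) (Fin n) ℂ) :
    Matrix (Fin n) (Fin n) ℂ :=
  ((n : ℝ) / ν.real Set.univ) •
    ∫ x : CProj n, (herm x.rep x.rep / herm (G⁻¹ *ᵥ x.rep) x.rep) • lineProj x.rep ∂ν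

end Donaldson

end

/-!
Choose a unit vector `z` on each line. The functional `H ↦ ∫ log ⟨H z, z⟩ - log det H / n` is
invariant under scaling and, by the stability condition, coercive modulo scaling, so it has a
minimum, and the inverse of a minimum is a fixed point. In coordinates in which the identity is
fixed, the trace decreases along the iteration by an amount which is quadratic in the distance to
the scalar matrices, while the linearisation `A ↦ n ∫ ⟨A z, z⟩ z z*` of the map at the identity is a
strict contraction on trace free Hermitian matrices.
-/

noncomputable section

namespace Donaldson

open Matrix Filter Topology
open Fintype (card)
open Module (finrank)
open WithLp (toLp)

variable {ι : Type*} [Fintype ι]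

open scoped MatrixOrder in
theorem exists_isUnit_eq_conjTranspose_mul_self [DecidableEq ι] {H : Matrix ι ι ℂ}
    (hH : H.PosDef) : ∃ B : Matrix ι ι ℂ, IsUnit B ∧ H = Bᴴ * B :=
  CStarAlgebra.isStrictlyPositive_iff_eq_star_mul_self.1 hH.isStrictlyPositive

-- The product topology of `Matrix` agrees with the topology of the Frobenius norm only after
-- unfolding, which instance search does not do.
local instance frobeniusTopology : TopologicalSpace (Matrix ι ι ℂ) :=
  (frobeniusNormedAddCommGroup (m := ι) (n := ι)
    (α := ℂ)).toPseudoMetricSpace.toUniformSpace.toTopologicalSpace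

/-! ### Quadratic forms and rank one matrices -/

/-- The real quadratic form `v ↦ re ⟨A v, v⟩` of a complex matrix. -/
def quadForm (A : Matrix ι ι ℂ) (v : ι → ℂ) : ℝ := (star v ⬝ᵥ A *ᵥ v).re

/-- The rank one matrix `v v*`; for a unit vector, the orthogonal projector onto its line. -/
def outer (v : ι → ℂ) : Matrix ι ι ℂ := vecMulVec v (star v)

theorem trace_mul_outer (A : Matrix ι ι ℂ) (v : ι → ℂ) :
    (A * outer v).trace = star v ⬝ᵥ A *ᵥ v := by
  rw [outer, mul_vecMulVec, trace_vecMulVec, dotProduct_comm]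

theorem quadForm_eq_re_trace (A : Matrix ι ι ℂ) (v : ι → ℂ) :
    quadForm A v = (A * outer v).trace.re := by
  rw [trace_mul_outer, quadForm]

omit [Fintype ι] in
theorem isHermitian_outer (v : ι → ℂ) : (outer v).IsHermitian := by
  rw [outer, IsHermitian, conjTranspose_vecMulVec, star_star]

theorem quadForm_add (A B : Matrix ι ι ℂ) (v : ι → ℂ) :
    quadForm (A + B) v = quadForm A v + quadForm B v := by
  simp [quadForm, add_mulVec, dotProduct_add]

theorem quadForm_sub (A B : Matrix ι ι ℂ) (v : ι → ℂ) :
    quadForm (A - B) v = quadForm A v - quadForm B v := by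
  simp [quadForm, sub_mulVec, dotProduct_sub]

theorem quadForm_smul (c : ℝ) (A : Matrix ι ι ℂ) (v : ι → ℂ) :
    quadForm (c • A) v = c * quadForm A v := by
  simp [quadForm, smul_mulVec, dotProduct_smul]

omit [Fintype ι] in
theorem outer_smul (c : ℝ) (v : ι → ℂ) : outer (c • v) = c ^ 2 • outer v := by
  ext i j
  simp only [outer, vecMulVec_apply, Matrix.smul_apply, Pi.smul_apply, Pi.star_apply, star_smul,
    star_trivial, Complex.real_smul, Complex.ofReal_pow]
  ring

theorem quadForm_smul_right (A : Matrix ι ι ℂ) (c : ℝ) (v : ι → ℂ) :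
    quadForm A (c • v) = c ^ 2 * quadForm A v := by
  rw [quadForm_eq_re_trace, outer_smul, quadForm_eq_re_trace, mul_smul_comm, trace_smul,
    Complex.smul_re, smul_eq_mul]

theorem quadForm_conj (R A : Matrix ι ι ℂ) (v : ι → ℂ) :
    quadForm (Rᴴ * A * R) v = quadForm A (R *ᵥ v) := by
  rw [quadForm, quadForm, mul_assoc, ← mulVec_mulVec, ← mulVec_mulVec, dotProduct_mulVec,
    star_mulVec]

theorem outer_mulVec (R : Matrix ι ι ℂ) (v : ι → ℂ) : outer (R *ᵥ v) = R * outer v * Rᴴ := by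
  rw [outer, outer, mul_vecMulVec, vecMulVec_mul, star_mulVec]

theorem quadForm_outer (u v : ι → ℂ) : quadForm (outer u) v = ‖star u ⬝ᵥ v‖ ^ 2 := by
  have hstar : star v ⬝ᵥ u = star (star u ⬝ᵥ v) := by rw [← star_dotProduct]
  rw [quadForm, outer, vecMulVec_mulVec]
  simp [dotProduct_smul, hstar, Complex.sq_norm, Complex.normSq_apply]

theorem re_star_dotProduct_self (v : ι → ℂ) : (star v ⬝ᵥ v).re = ‖toLp 2 v‖ ^ 2 := by
  rw [dotProduct_comm, ← EuclideanSpace.inner_toLp_toLp]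
  exact inner_self_eq_norm_sq (𝕜 := ℂ) _

theorem quadForm_conjTranspose_mul_self (B : Matrix ι ι ℂ) (v : ι → ℂ) :
    quadForm (Bᴴ * B) v = ‖toLp 2 (B *ᵥ v)‖ ^ 2 := by
  rw [← re_star_dotProduct_self, quadForm, ← mulVec_mulVec, dotProduct_mulVec, star_mulVec]

theorem norm_toLp_mulVec_le (A : Matrix ι ι ℂ) (v : ι → ℂ) :
    ‖toLp 2 (A *ᵥ v)‖ ≤ ‖A‖ * ‖toLp 2 v‖ := by
  rw [← frobenius_norm_replicateCol (ι := Unit), ← frobenius_norm_replicateCol (ι := Unit),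
    replicateCol_mulVec]
  exact frobenius_norm_mul _ _

theorem abs_quadForm_le (A : Matrix ι ι ℂ) (v : ι → ℂ) :
    |quadForm A v| ≤ ‖A‖ * ‖toLp 2 v‖ ^ 2 := by
  rw [quadForm, dotProduct_comm, ← EuclideanSpace.inner_toLp_toLp]
  calc _ ≤ ‖inner ℂ (toLp 2 v) (toLp 2 (A *ᵥ v))‖ := Complex.abs_re_le_norm _
    _ ≤ ‖toLp 2 v‖ * ‖toLp 2 (A *ᵥ v)‖ := norm_inner_le_norm _ _
    _ ≤ ‖toLp 2 v‖ * (‖A‖ * ‖toLp 2 v‖) := by gcongr; exact norm_toLp_mulVec_le A v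
    _ = _ := by ring

theorem frobenius_norm_sq (A : Matrix ι ι ℂ) : ‖A‖ ^ 2 = (Aᴴ * A).trace.re := by
  rw [frobenius_norm_def, ← Real.sqrt_eq_rpow, Real.sq_sqrt (by positivity), trace,
    Finset.sum_comm]
  simp [mul_apply, Complex.sq_norm, Complex.normSq_apply]

theorem norm_outer (v : ι → ℂ) : ‖outer v‖ = ‖toLp 2 v‖ ^ 2 := by
  have hsq : ‖outer v‖ ^ 2 = (‖toLp 2 v‖ ^ 2) ^ 2 := by
    rw [frobenius_norm_sq, (isHermitian_outer v).eq, ← quadForm_eq_re_trace, quadForm_outer,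
      ← re_star_dotProduct_self, Complex.sq_norm, Complex.normSq_apply]
    have him : (star v ⬝ᵥ v).im = 0 := by simp [dotProduct, mul_comm]
    rw [him, mul_zero, add_zero, sq]
  exact (sq_eq_sq₀ (norm_nonneg _) (by positivity)).1 hsq

theorem star_dotProduct_mulVec_eq_quadForm {A : Matrix ι ι ℂ} (hA : A.IsHermitian) (v : ι → ℂ) :
    star v ⬝ᵥ A *ᵥ v = (quadForm A v : ℂ) :=
  Complex.ext (by simp [quadForm]) (by simpa using hA.im_star_dotProduct_mulVec_self v)

theorem quadForm_pos {A : Matrix ι ι ℂ} (hA : A.PosDef) {v : ι → ℂ} (hv : v ≠ 0) :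
    0 < quadForm A v := by
  have hpos := hA.dotProduct_mulVec_pos hv
  rw [star_dotProduct_mulVec_eq_quadForm hA.1] at hpos
  exact_mod_cast hpos

theorem quadForm_nonneg {A : Matrix ι ι ℂ} (hA : A.PosDef) (v : ι → ℂ) : 0 ≤ quadForm A v := by
  rcases eq_or_ne v 0 with rfl | hv
  · simp [quadForm]
  · exact (quadForm_pos hA hv).le

theorem posDef_of_quadForm_pos {A : Matrix ι ι ℂ} (hA : A.IsHermitian)
    (hpos : ∀ v, v ≠ 0 → 0 < quadForm A v) : A.PosDef := by
  refine .of_dotProduct_mulVec_pos hA fun {v} hv => ?_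
  rw [star_dotProduct_mulVec_eq_quadForm hA]
  exact_mod_cast hpos v hv

theorem continuous_quadForm (v : ι → ℂ) : Continuous fun A => quadForm A v := by
  unfold quadForm; fun_prop

theorem ne_zero_of_norm_toLp_eq_one {v : ι → ℂ} (hv : ‖toLp 2 v‖ = 1) : v ≠ 0 := by
  rintro rfl; simp at hv

/-- The unit vector in the direction of `v ≠ 0`, for the Hermitian norm: the norm of the type
`ι → ℂ` itself is the supremum norm. -/
def unitVec (v : ι → ℂ) : ι → ℂ := ‖toLp 2 v‖⁻¹ • v

theorem norm_unitVec {v : ι → ℂ} (hv : v ≠ 0) : ‖toLp 2 (unitVec v)‖ = 1 := by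
  have hnorm : ‖toLp 2 v‖ ≠ 0 := by simpa using hv
  rw [unitVec, WithLp.toLp_smul, norm_smul, norm_inv, norm_norm, inv_mul_cancel₀ hnorm]

theorem outer_unitVec (v : ι → ℂ) : outer (unitVec v) = (‖toLp 2 v‖ ^ 2)⁻¹ • outer v := by
  rw [unitVec, outer_smul, inv_pow]

theorem quadForm_unitVec (A : Matrix ι ι ℂ) (v : ι → ℂ) :
    quadForm A (unitVec v) = (‖toLp 2 v‖ ^ 2)⁻¹ * quadForm A v := by
  rw [unitVec, quadForm_smul_right, inv_pow]

theorem unitVec_mem_iff {v : ι → ℂ} (hv : v ≠ 0) (W : Submodule ℂ (ι → ℂ)) :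
    unitVec v ∈ W ↔ v ∈ W := by
  have hnorm : ‖toLp 2 v‖⁻¹ ≠ 0 := by simpa using hv
  exact (W.restrictScalars ℝ).smul_mem_iff hnorm

/-! ### Diagonalisation of positive definite matrices -/

section Diagonalisation

variable [DecidableEq ι]

theorem quadForm_one (v : ι → ℂ) : quadForm 1 v = ‖toLp 2 v‖ ^ 2 := by
  rw [quadForm, one_mulVec, re_star_dotProduct_self]

/-- The matrix with eigenvalues `d` and eigenvectors the columns of a unitary matrix `U`. -/
def conjDiag (U : Matrix ι ι ℂ) (d : ι → ℝ) : Matrix ι ι ℂ :=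
  U * diagonal (fun i => (d i : ℂ)) * Uᴴ

theorem exists_eq_conjDiag {H : Matrix ι ι ℂ} (hH : H.PosDef) :
    ∃ U ∈ unitaryGroup ι ℂ, ∃ d : ι → ℝ, (∀ i, 0 < d i) ∧ H = conjDiag U d :=
  ⟨hH.1.eigenvectorUnitary, hH.1.eigenvectorUnitary.2, hH.1.eigenvalues, hH.eigenvalues_pos,
    hH.1.spectral_theorem⟩

theorem quadForm_conjDiag (U : Matrix ι ι ℂ) (d : ι → ℝ) (v : ι → ℂ) :
    quadForm (conjDiag U d) v = ∑ i, d i * ‖(Uᴴ *ᵥ v) i‖ ^ 2 := by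
  have hconj := quadForm_conj Uᴴ (diagonal fun i => (d i : ℂ)) v
  rw [conjTranspose_conjTranspose] at hconj
  rw [conjDiag, hconj, quadForm]
  simp only [dotProduct, mulVec_diagonal, Complex.re_sum]
  refine Finset.sum_congr rfl fun i _ => ?_
  simp only [Pi.star_apply, RCLike.star_def, Complex.sq_norm, Complex.normSq_apply,
    Complex.mul_re, Complex.conj_re, Complex.conj_im, Complex.mul_im, Complex.ofReal_re,
    Complex.ofReal_im]
  ring

section Unitary

variable {U : Matrix ι ι ℂ} (hU : U ∈ unitaryGroup ι ℂ)
include hU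

theorem conjTranspose_mul_self_of_mem_unitaryGroup : Uᴴ * U = 1 := mem_unitaryGroup_iff'.1 hU

theorem mul_conjTranspose_self_of_mem_unitaryGroup : U * Uᴴ = 1 := mem_unitaryGroup_iff.1 hU

theorem conjDiag_one : conjDiag U 1 = 1 := by
  simp [conjDiag, mul_conjTranspose_self_of_mem_unitaryGroup hU]

theorem det_conjDiag (d : ι → ℝ) : (conjDiag U d).det = ((∏ i, d i : ℝ) : ℂ) := by
  rw [conjDiag, det_mul_comm, ← mul_assoc, conjTranspose_mul_self_of_mem_unitaryGroup hU, one_mul,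
    det_diagonal, Complex.ofReal_prod]

theorem trace_conjDiag (d : ι → ℝ) : (conjDiag U d).trace = ((∑ i, d i : ℝ) : ℂ) := by
  rw [conjDiag, trace_mul_comm, ← mul_assoc, conjTranspose_mul_self_of_mem_unitaryGroup hU,
    one_mul, trace_diagonal, Complex.ofReal_sum]

theorem sum_norm_sq_conjTranspose_mulVec (v : ι → ℂ) :
    ∑ i, ‖(Uᴴ *ᵥ v) i‖ ^ 2 = ‖toLp 2 v‖ ^ 2 := by
  rw [← quadForm_one, ← conjDiag_one hU, quadForm_conjDiag]
  simp

theorem posDef_conjDiag {d : ι → ℝ} (hd : ∀ i, 0 < d i) : (conjDiag U d).PosDef := by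
  refine (PosDef.diagonal fun i => ?_).mul_mul_conjTranspose_same ?_
  · exact_mod_cast hd i
  · exact vecMul_injective_of_isUnit
      (IsUnit.of_mul_eq_one _ (mul_conjTranspose_self_of_mem_unitaryGroup hU))

end Unitary

end Diagonalisation

theorem exists_mul_norm_sq_le_quadForm {H : Matrix ι ι ℂ} (hH : H.PosDef) :
    ∃ c > 0, ∀ v : ι → ℂ, c * ‖toLp 2 v‖ ^ 2 ≤ quadForm H v := by
  classical
  obtain ⟨B, hB, rfl⟩ := exists_isUnit_eq_conjTranspose_mul_self hH
  refine ⟨((‖B⁻¹‖ + 1) ^ 2)⁻¹, by positivity, fun v => ?_⟩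
  have hv : ‖toLp 2 v‖ ≤ ‖B⁻¹‖ * ‖toLp 2 (B *ᵥ v)‖ := by
    simpa [nonsing_inv_mul _ ((isUnit_iff_isUnit_det B).1 hB)] using
      norm_toLp_mulVec_le B⁻¹ (B *ᵥ v)
  rw [quadForm_conjTranspose_mul_self, inv_mul_le_iff₀ (by positivity), ← mul_pow]
  gcongr
  exact hv.trans (by gcongr; linarith)

theorem quadForm_mulVec_sub_smul {A M : Matrix ι ι ℂ} (hA : A.IsHermitian) (hAM : Commute A M)
    (c : ℝ) (v : ι → ℂ) :
    quadForm M (A *ᵥ v - c • v) =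
      quadForm (Aᴴ * M * A) v - 2 * c * quadForm (M * A) v + c ^ 2 * quadForm M v := by
  classical
  have hmulVec : A *ᵥ v - c • v = (A - c • (1 : Matrix ι ι ℂ)) *ᵥ v := by
    rw [sub_mulVec, smul_mulVec, one_mulVec]
  have hmul : (A - c • (1 : Matrix ι ι ℂ))ᴴ * M * (A - c • (1 : Matrix ι ι ℂ)) =
      Aᴴ * M * A - (2 * c) • (M * A) + (c ^ 2) • M := by
    rw [conjTranspose_sub, conjTranspose_smul, conjTranspose_one, hA.eq]
    simp only [star_trivial, sub_mul, mul_sub, smul_mul_assoc, mul_smul_comm, one_mul, mul_one,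
      hAM.eq]
    module
  rw [hmulVec, ← quadForm_conj, hmul, quadForm_add, quadForm_sub, quadForm_smul, quadForm_smul]

theorem norm_sq_mulVec_sub_smul {A : Matrix ι ι ℂ} (hA : A.IsHermitian) (c : ℝ) (v : ι → ℂ) :
    ‖toLp 2 (A *ᵥ v - c • v)‖ ^ 2 =
      quadForm (Aᴴ * A) v - 2 * c * quadForm A v + c ^ 2 * ‖toLp 2 v‖ ^ 2 := by
  classical
  simpa [quadForm_one] using quadForm_mulVec_sub_smul hA (Commute.one_right A) c v

theorem norm_sq_mulVec_sub_quadForm_smul {A : Matrix ι ι ℂ} (hA : A.IsHermitian) {v : ι → ℂ}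
    (hv : ‖toLp 2 v‖ = 1) :
    ‖toLp 2 (A *ᵥ v - quadForm A v • v)‖ ^ 2 = quadForm (Aᴴ * A) v - quadForm A v ^ 2 := by
  rw [norm_sq_mulVec_sub_smul hA, hv]
  ring

theorem sq_quadForm_le {A : Matrix ι ι ℂ} (hA : A.IsHermitian) {v : ι → ℂ}
    (hv : ‖toLp 2 v‖ = 1) : quadForm A v ^ 2 ≤ quadForm (Aᴴ * A) v := by
  rw [← sub_nonneg, ← norm_sq_mulVec_sub_quadForm_smul hA hv]
  positivity

theorem mulVec_eq_of_quadForm_eq_sq {A : Matrix ι ι ℂ} (hA : A.IsHermitian) {v : ι → ℂ}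
    (hv : ‖toLp 2 v‖ = 1) (hsq : quadForm (Aᴴ * A) v = quadForm A v ^ 2) :
    A *ᵥ v = quadForm A v • v := by
  have hnorm := norm_sq_mulVec_sub_quadForm_smul hA hv
  rw [hsq, sub_self, sq_eq_zero_iff, norm_eq_zero, WithLp.toLp_eq_zero] at hnorm
  exact sub_eq_zero.1 hnorm

/-! ### Families of unit vectors -/

variable {X : Type*} [MeasurableSpace X]

/-- A family of unit vectors of `ℂ^ι` whose lines depend measurably on the parameter. Only the
projectors `z x (z x)*` are required to be measurable, so that the vector can be chosen on each line
without any care. -/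
structure UnitFrame (z : X → ι → ℂ) : Prop where
  stronglyMeasurable_outer : StronglyMeasurable fun x => outer (z x)
  norm_eq_one : ∀ x, ‖toLp 2 (z x)‖ = 1

/-- A family of unit vectors which is stable in the sense of geometric invariant theory: every
proper non-zero subspace `W` contains `z x` with probability less than `dim W / dim ℂ^ι`. -/
structure StableFrame (μ : Measure X) (z : X → ι → ℂ) : Prop extends UnitFrame z where
  measure_mem_lt : ∀ W : Submodule ℂ (ι → ℂ), W ≠ ⊥ → W ≠ ⊤ →
    μ.real {x | z x ∈ W} < (finrank ℂ W : ℝ) / card ι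

/-- The frame operator `n ∫ w z z*` of a family of vectors with weights `w`, where `n` is the
dimension. -/
def frameOperator (μ : Measure X) (z : X → ι → ℂ) (w : X → ℝ) : Matrix ι ι ℂ :=
  (card ι : ℝ) • ∫ x, w x • outer (z x) ∂μ

/-- The linearisation of `frameMap μ z` at the identity, when the identity is a fixed point. -/
def linearization (μ : Measure X) (z : X → ι → ℂ) (A : Matrix ι ι ℂ) : Matrix ι ι ℂ :=
  frameOperator μ z fun x => quadForm A (z x)

variable {μ : Measure X} {z : X → ι → ℂ}

theorem frameOperator_const_mul (c : ℝ) (w : X → ℝ) :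
    frameOperator μ z (fun x => c * w x) = c • frameOperator μ z w := by
  simp only [frameOperator, mul_smul, integral_smul]
  rw [smul_comm]

theorem isHermitian_frameOperator (w : X → ℝ) : (frameOperator μ z w).IsHermitian := by
  have hint : star (∫ x, w x • outer (z x) ∂μ) = ∫ x, w x • outer (z x) ∂μ := by
    rw [← starL'_apply (R := ℝ), ← (starL' ℝ).integral_comp_comm]
    refine integral_congr_ae (.of_forall fun x => ?_)
    simp [star_eq_conjTranspose, (isHermitian_outer (z x)).eq]
  rw [frameOperator, IsHermitian, conjTranspose_smul, star_trivial]
  exact congrArg _ hint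

namespace UnitFrame

variable (hz : UnitFrame z)
include hz

theorem ne_zero (x : X) : z x ≠ 0 := ne_zero_of_norm_toLp_eq_one (hz.norm_eq_one x)

theorem norm_outer_eq_one (x : X) : ‖outer (z x)‖ = 1 := by
  rw [norm_outer, hz.norm_eq_one, one_pow]

theorem abs_quadForm_le_norm (A : Matrix ι ι ℂ) (x : X) : |quadForm A (z x)| ≤ ‖A‖ := by
  simpa [hz.norm_eq_one] using abs_quadForm_le A (z x)

theorem quadForm_pos {A : Matrix ι ι ℂ} (hA : A.PosDef) (x : X) : 0 < quadForm A (z x) :=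
  Donaldson.quadForm_pos hA (hz.ne_zero x)

theorem quadForm_one_eq_one [DecidableEq ι] (x : X) : quadForm 1 (z x) = 1 := by
  rw [quadForm_one, hz.norm_eq_one, one_pow]

theorem exists_le_quadForm {H : Matrix ι ι ℂ} (hH : H.PosDef) :
    ∃ c > 0, ∀ x, c ≤ quadForm H (z x) := by
  obtain ⟨c, hc, hle⟩ := exists_mul_norm_sq_le_quadForm hH
  exact ⟨c, hc, fun x => by simpa [hz.norm_eq_one] using hle (z x)⟩

theorem measurable_quadForm (A : Matrix ι ι ℂ) : Measurable fun x => quadForm A (z x) := by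
  simp only [quadForm_eq_re_trace]
  have hcont : Continuous fun M : Matrix ι ι ℂ => (A * M).trace.re := by fun_prop
  exact (hcont.comp_stronglyMeasurable hz.stronglyMeasurable_outer).measurable

theorem integrable_quadForm [IsFiniteMeasure μ] (A : Matrix ι ι ℂ) :
    Integrable (fun x => quadForm A (z x)) μ :=
  .of_bound (hz.measurable_quadForm A).aestronglyMeasurable ‖A‖
    (.of_forall fun x => hz.abs_quadForm_le_norm A x)

theorem integrable_mul_quadForm {w : X → ℝ} (hw : Integrable w μ) (A : Matrix ι ι ℂ) :
    Integrable (fun x => w x * quadForm A (z x)) μ :=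
  hw.mul_bdd (c := ‖A‖) (hz.measurable_quadForm A).aestronglyMeasurable
    (.of_forall fun x => hz.abs_quadForm_le_norm A x)

theorem integrable_sq_quadForm [IsFiniteMeasure μ] (A : Matrix ι ι ℂ) :
    Integrable (fun x => quadForm A (z x) ^ 2) μ := by
  simpa only [sq] using hz.integrable_mul_quadForm (hz.integrable_quadForm A) A

theorem integrable_inv_quadForm [IsFiniteMeasure μ] {H : Matrix ι ι ℂ} (hH : H.PosDef) :
    Integrable (fun x => (quadForm H (z x))⁻¹) μ := by
  obtain ⟨c, hc, hle⟩ := hz.exists_le_quadForm hH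
  refine .of_bound (hz.measurable_quadForm H).inv.aestronglyMeasurable c⁻¹
    (.of_forall fun x => ?_)
  rw [norm_inv, Real.norm_eq_abs, abs_of_pos (hz.quadForm_pos hH x)]
  gcongr
  exact hle x

theorem integrable_smul_outer {w : X → ℝ} (hw : Integrable w μ) :
    Integrable (fun x => w x • outer (z x)) μ := by
  refine hw.mono
    (hw.aestronglyMeasurable.smul hz.stronglyMeasurable_outer.aestronglyMeasurable)
    (.of_forall fun x => ?_)
  rw [norm_smul, hz.norm_outer_eq_one, mul_one]

theorem re_trace_mul_frameOperator {w : X → ℝ} (hw : Integrable w μ) (A : Matrix ι ι ℂ) :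
    (A * frameOperator μ z w).trace.re = card ι * ∫ x, w x * quadForm A (z x) ∂μ := by
  let traceMul : Matrix ι ι ℂ →ₗ[ℝ] ℝ :=
    { toFun := fun M => (A * M).trace.re
      map_add' := fun M N => by simp [mul_add]
      map_smul' := fun c M => by simp }
  have hcomm :=
    (LinearMap.toContinuousLinearMap traceMul).integral_comp_comm (hz.integrable_smul_outer hw)
  have hpoint (x : X) : LinearMap.toContinuousLinearMap traceMul (w x • outer (z x)) =
      w x * quadForm A (z x) := by
    simp [traceMul, quadForm_eq_re_trace]
  simp only [hpoint] at hcomm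
  rw [hcomm, frameOperator, mul_smul_comm, trace_smul, Complex.smul_re, smul_eq_mul]
  rfl

theorem re_trace_frameOperator {w : X → ℝ} (hw : Integrable w μ) :
    (frameOperator μ z w).trace.re = card ι * ∫ x, w x ∂μ := by
  classical
  simpa [hz.quadForm_one_eq_one] using hz.re_trace_mul_frameOperator hw 1

theorem frameOperator_sub {w w' : X → ℝ} (hw : Integrable w μ) (hw' : Integrable w' μ) :
    frameOperator μ z (fun x => w x - w' x) = frameOperator μ z w - frameOperator μ z w' := by
  simp only [frameOperator, sub_smul]
  rw [integral_sub (hz.integrable_smul_outer hw) (hz.integrable_smul_outer hw'), smul_sub]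

theorem norm_frameOperator_le (w : X → ℝ) : ‖frameOperator μ z w‖ ≤ card ι * ∫ x, |w x| ∂μ := by
  rw [frameOperator, norm_smul, Real.norm_natCast]
  gcongr
  refine (norm_integral_le_integral_norm _).trans_eq ?_
  simp only [norm_smul, hz.norm_outer_eq_one, mul_one, Real.norm_eq_abs]

end UnitFrame

namespace StableFrame

variable (hz : StableFrame μ z)
include hz

theorem not_ae_mem [IsProbabilityMeasure μ] {W : Submodule ℂ (ι → ℂ)} (hW : W ≠ ⊤) :
    ¬ ∀ᵐ x ∂μ, z x ∈ W := by
  intro hmem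
  have hbot : W ≠ ⊥ := by
    rintro rfl
    obtain ⟨x, hx⟩ := hmem.exists
    exact hz.ne_zero x (by simpa using hx)
  have hone : μ.real {x | z x ∈ W} = 1 := by
    rw [measureReal_congr (eventuallyEq_univ.2 hmem), probReal_univ]
  have hdim : (finrank ℂ W : ℝ) / card ι ≤ 1 := by
    refine div_le_one_of_le₀ (Nat.cast_le.2 ?_) (Nat.cast_nonneg _)
    simpa only [Module.finrank_fintype_fun_eq_card] using Submodule.finrank_le W
  linarith [hz.measure_mem_lt W hbot hW]

theorem not_ae_mem_or_mem [IsProbabilityMeasure μ] {V W : Submodule ℂ (ι → ℂ)}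
    (hV : V ≠ ⊥) (hV' : V ≠ ⊤) (hW : W ≠ ⊥) (hW' : W ≠ ⊤)
    (hdim : finrank ℂ V + finrank ℂ W ≤ card ι) : ¬ ∀ᵐ x ∂μ, z x ∈ V ∨ z x ∈ W := by
  intro hmem
  have hone : 1 ≤ μ.real {x | z x ∈ V} + μ.real {x | z x ∈ W} := by
    rw [← probReal_univ (μ := μ), ← measureReal_congr (eventuallyEq_univ.2 hmem)]
    exact measureReal_union_le _ _
  have hdim' : (finrank ℂ V : ℝ) / card ι + (finrank ℂ W : ℝ) / card ι ≤ 1 := by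
    rw [← add_div]
    exact div_le_one_of_le₀ (by exact_mod_cast hdim) (Nat.cast_nonneg _)
  linarith [hz.measure_mem_lt V hV hV', hz.measure_mem_lt W hW hW']

end StableFrame

/-! ### Donaldson's map of a family of unit vectors -/

variable [DecidableEq ι]

/-- Donaldson's map of a family of unit vectors. -/
def frameMap (μ : Measure X) (z : X → ι → ℂ) (G : Matrix ι ι ℂ) : Matrix ι ι ℂ :=
  frameOperator μ z fun x => (quadForm G⁻¹ (z x))⁻¹

namespace UnitFrame

variable (hz : UnitFrame z)
include hz

theorem frameMap_one : frameMap μ z 1 = frameOperator μ z 1 := by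
  simp only [frameMap, inv_one, hz.quadForm_one_eq_one, Pi.one_def]

theorem re_trace_mul_frameMap [IsFiniteMeasure μ] {G : Matrix ι ι ℂ} (hG : G.PosDef)
    (A : Matrix ι ι ℂ) : (A * frameMap μ z G).trace.re =
      card ι * ∫ x, (quadForm G⁻¹ (z x))⁻¹ * quadForm A (z x) ∂μ :=
  hz.re_trace_mul_frameOperator (hz.integrable_inv_quadForm hG.inv) A

theorem quadForm_frameMap [IsFiniteMeasure μ] {G : Matrix ι ι ℂ} (hG : G.PosDef) (v : ι → ℂ) :
    quadForm (frameMap μ z G) v =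
      card ι * ∫ x, (quadForm G⁻¹ (z x))⁻¹ * ‖star v ⬝ᵥ z x‖ ^ 2 ∂μ := by
  simp only [← quadForm_outer]
  rw [quadForm_eq_re_trace, trace_mul_comm, hz.re_trace_mul_frameMap hG]

end UnitFrame

namespace StableFrame

variable (hz : StableFrame μ z)
include hz

theorem posDef_frameMap [IsProbabilityMeasure μ] [Nonempty ι] {G : Matrix ι ι ℂ}
    (hG : G.PosDef) : (frameMap μ z G).PosDef := by
  refine posDef_of_quadForm_pos (isHermitian_frameOperator _) fun v hv => ?_
  rw [hz.quadForm_frameMap hG]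
  refine mul_pos (by positivity) ?_
  have hpos := hz.quadForm_pos hG.inv
  have hnonneg (x : X) : 0 ≤ (quadForm G⁻¹ (z x))⁻¹ * ‖star v ⬝ᵥ z x‖ ^ 2 :=
    mul_nonneg (inv_nonneg.2 (hpos x).le) (sq_nonneg _)
  have hint : Integrable (fun x => (quadForm G⁻¹ (z x))⁻¹ * ‖star v ⬝ᵥ z x‖ ^ 2) μ := by
    simpa only [quadForm_outer] using
      hz.integrable_mul_quadForm (hz.integrable_inv_quadForm hG.inv) (outer v)
  refine (integral_nonneg hnonneg).lt_of_ne' fun hzero => ?_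
  rw [integral_eq_zero_iff_of_nonneg hnonneg hint] at hzero
  let orthogonal : Submodule ℂ (ι → ℂ) := LinearMap.ker (dotProductBilin ℂ ℂ (star v))
  have horth : orthogonal ≠ ⊤ := by
    intro htop
    have hmem : v ∈ orthogonal := htop ▸ Submodule.mem_top
    exact hv (dotProduct_star_self_eq_zero.1 (by simpa [orthogonal, dotProduct_comm] using hmem))
  refine hz.not_ae_mem horth ?_
  filter_upwards [hzero] with x hx
  simpa [orthogonal, (hpos x).ne'] using hx

end StableFrame

/-! ### The spectral gap of the linearisation -/

namespace StableFrame

-- Subtracting an eigenvalue `c` from `A`, almost every vector lies in the kernel of `A - c` (if its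
-- eigenvalue is `c`) or in the range of `A - c` (otherwise), whose dimensions add up to the total.
theorem eq_smul_one_of_ae_eigenvector [IsProbabilityMeasure μ] [Nonempty ι]
    (hz : StableFrame μ z) {A : Matrix ι ι ℂ} (hA : A.IsHermitian)
    (heig : ∀ᵐ x ∂μ, A *ᵥ z x = quadForm A (z x) • z x) : ∃ c : ℝ, A = c • 1 := by
  let i : ι := Classical.arbitrary ι
  let c := hA.eigenvalues i
  let f : (ι → ℂ) →ₗ[ℂ] (ι → ℂ) := mulVecLin (A - c • 1)
  have hf (v : ι → ℂ) : f v = A *ᵥ v - c • v := by simp [f]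
  refine ⟨c, by_contra fun hne => ?_⟩
  have hf0 : f ≠ 0 := fun h0 =>
    hne (sub_eq_zero.1 (toLin'.injective (h0.trans toLin'.map_zero.symm)))
  have hker : LinearMap.ker f ≠ ⊥ := by
    have hmem : ⇑(hA.eigenvectorBasis i) ∈ LinearMap.ker f := by
      rw [LinearMap.mem_ker, hf, hA.mulVec_eigenvectorBasis i]
      exact sub_self _
    refine (Submodule.ne_bot_iff _).2 ⟨_, hmem, fun h0 => ?_⟩
    exact hA.eigenvectorBasis.orthonormal.ne_zero i (by ext j; exact congrFun h0 j)
  refine hz.not_ae_mem_or_mem hker (hf0 ∘ LinearMap.ker_eq_top.1)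
    (hf0 ∘ LinearMap.range_eq_bot.1) (hker ∘ LinearMap.ker_eq_bot_iff_range_eq_top.2)
    (by rw [add_comm, f.finrank_range_add_finrank_ker, Module.finrank_fintype_fun_eq_card]) ?_
  filter_upwards [heig] with x hx
  by_cases hc : quadForm A (z x) = c
  · exact .inl (by rw [LinearMap.mem_ker, hf, hx, hc, sub_self])
  · refine .inr ⟨(quadForm A (z x) - c)⁻¹ • z x, ?_⟩
    rw [hf, mulVec_smul, hx, smul_comm c, ← smul_sub, ← sub_smul, smul_smul,
      inv_mul_cancel₀ (sub_ne_zero.2 hc), one_smul]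

end StableFrame

namespace UnitFrame

theorem continuousOn_integral_sq_quadForm [IsFiniteMeasure μ] (hz : UnitFrame z) :
    ContinuousOn (fun A => ∫ x, quadForm A (z x) ^ 2 ∂μ)
      (Metric.closedBall (0 : Matrix ι ι ℂ) 1) := by
  refine continuousOn_of_dominated (bound := fun _ => 1)
    (fun A _ => (hz.integrable_sq_quadForm A).aestronglyMeasurable)
    (fun A hA => .of_forall fun x => ?_) (integrable_const _)
    (.of_forall fun x => ((continuous_quadForm (z x)).pow 2).continuousOn)
  rw [norm_pow, Real.norm_eq_abs]
  exact pow_le_one₀ (abs_nonneg _)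
    ((hz.abs_quadForm_le_norm A x).trans (mem_closedBall_zero_iff.1 hA))

variable [IsFiniteMeasure μ] (hz : UnitFrame z) (hb : frameOperator μ z 1 = 1)
include hz hb

theorem integral_quadForm_of_balanced (A : Matrix ι ι ℂ) :
    card ι * ∫ x, quadForm A (z x) ∂μ = A.trace.re := by
  simpa [hb] using (hz.re_trace_mul_frameOperator (w := 1) (integrable_const (μ := μ) 1) A).symm

theorem integral_sq_quadForm_le {A : Matrix ι ι ℂ} (hA : A.IsHermitian) :
    card ι * ∫ x, quadForm A (z x) ^ 2 ∂μ ≤ ‖A‖ ^ 2 := by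
  rw [frobenius_norm_sq, ← hz.integral_quadForm_of_balanced hb]
  gcongr ?_ * ?_
  exact integral_mono (hz.integrable_sq_quadForm A) (hz.integrable_quadForm _)
    fun x => sq_quadForm_le hA (hz.norm_eq_one x)

theorem norm_sq_linearization_le (A : Matrix ι ι ℂ) :
    ‖linearization μ z A‖ ^ 2 ≤ card ι * ∫ x, quadForm A (z x) ^ 2 ∂μ := by
  set L := linearization μ z A with hL
  have hLH : L.IsHermitian := isHermitian_frameOperator _
  have hnorm : ‖L‖ ^ 2 = card ι * ∫ x, quadForm A (z x) * quadForm L (z x) ∂μ := by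
    rw [frobenius_norm_sq, hLH.eq, ← hz.re_trace_mul_frameOperator (hz.integrable_quadForm A),
      ← linearization, ← hL]
  have hamgm : ∫ x, quadForm A (z x) * quadForm L (z x) ∂μ ≤
      (∫ x, quadForm A (z x) ^ 2 ∂μ + ∫ x, quadForm L (z x) ^ 2 ∂μ) / 2 := by
    rw [← integral_add (hz.integrable_sq_quadForm A) (hz.integrable_sq_quadForm L),
      ← integral_div]
    refine integral_mono (hz.integrable_mul_quadForm (hz.integrable_quadForm A) L)
      (((hz.integrable_sq_quadForm A).add (hz.integrable_sq_quadForm L)).div_const 2) fun x => ?_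
    dsimp only
    linarith [two_mul_le_add_sq (quadForm A (z x)) (quadForm L (z x))]
  have hself := hz.integral_sq_quadForm_le hb hLH
  have hscaled := mul_le_mul_of_nonneg_left hamgm (Nat.cast_nonneg (α := ℝ) (card ι))
  linarith

end UnitFrame

theorem isCompact_traceless_sphere :
    IsCompact (Metric.sphere (0 : Matrix ι ι ℂ) 1 ∩ {A | A.IsHermitian ∧ A.trace.re = 0}) := by
  have htrace : Continuous fun A : Matrix ι ι ℂ => A.trace.re := by fun_prop
  exact (isCompact_sphere 0 1).inter_right
    ((isClosed_eq continuous_star continuous_id).inter (isClosed_eq htrace continuous_const))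

namespace StableFrame

variable [IsProbabilityMeasure μ] [Nonempty ι] (hz : StableFrame μ z)
  (hb : frameOperator μ z 1 = 1)
include hz hb

theorem integral_sq_quadForm_lt {A : Matrix ι ι ℂ} (hA : A.IsHermitian) (htr : A.trace.re = 0)
    (hA0 : A ≠ 0) : card ι * ∫ x, quadForm A (z x) ^ 2 ∂μ < ‖A‖ ^ 2 := by
  refine (hz.integral_sq_quadForm_le hb hA).lt_of_ne fun heq => hA0 ?_
  rw [frobenius_norm_sq, ← hz.integral_quadForm_of_balanced hb] at heq
  have hzero : ∫ x, (quadForm (Aᴴ * A) (z x) - quadForm A (z x) ^ 2) ∂μ = 0 := by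
    rw [integral_sub (hz.integrable_quadForm _) (hz.integrable_sq_quadForm A),
      mul_left_cancel₀ (by positivity) heq, sub_self]
  rw [integral_eq_zero_iff_of_nonneg
    (fun x => sub_nonneg.2 (sq_quadForm_le hA (hz.norm_eq_one x)))
    ((hz.integrable_quadForm _).sub (hz.integrable_sq_quadForm A))] at hzero
  obtain ⟨c, rfl⟩ := hz.eq_smul_one_of_ae_eigenvector hA (by
    filter_upwards [hzero] with x hx
    exact mulVec_eq_of_quadForm_eq_sq hA (hz.norm_eq_one x) (sub_eq_zero.1 hx))
  have hc : c = 0 := by simpa using htr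
  rw [hc, zero_smul]

theorem exists_integral_sq_quadForm_le_mul :
    ∃ m : ℝ, 0 ≤ m ∧ m < 1 ∧ ∀ A : Matrix ι ι ℂ, A.IsHermitian → A.trace.re = 0 →
      card ι * ∫ x, quadForm A (z x) ^ 2 ∂μ ≤ m * ‖A‖ ^ 2 := by
  set S := Metric.sphere (0 : Matrix ι ι ℂ) 1 ∩ {A | A.IsHermitian ∧ A.trace.re = 0}
  obtain ⟨m, hm0, hm1, hm⟩ : ∃ m : ℝ, 0 ≤ m ∧ m < 1 ∧
      ∀ A ∈ S, card ι * ∫ x, quadForm A (z x) ^ 2 ∂μ ≤ m := by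
    rcases S.eq_empty_or_nonempty with hempty | hne
    · exact ⟨0, le_rfl, one_pos, by simp [hempty]⟩
    obtain ⟨A, ⟨hA1, hAH, htr⟩, hmax⟩ := isCompact_traceless_sphere.exists_isMaxOn hne
      ((hz.continuousOn_integral_sq_quadForm (μ := μ)).mono
        (Set.inter_subset_left.trans Metric.sphere_subset_closedBall))
    rw [mem_sphere_zero_iff_norm] at hA1
    have hlt := hz.integral_sq_quadForm_lt hb hAH htr (norm_ne_zero_iff.1 (by simp [hA1]))
    exact ⟨card ι * ∫ x, quadForm A (z x) ^ 2 ∂μ, by positivity, by simpa [hA1] using hlt,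
      fun B hB => mul_le_mul_of_nonneg_left (hmax hB) (Nat.cast_nonneg _)⟩
  refine ⟨m, hm0, hm1, fun A hA htr => ?_⟩
  rcases eq_or_ne A 0 with rfl | hA0
  · simp [quadForm]
  have hpos : 0 < ‖A‖ := norm_pos_iff.2 hA0
  have hunit := hm (‖A‖⁻¹ • A) ⟨by simp [norm_smul, hpos.ne'],
    by rw [IsHermitian, conjTranspose_smul, hA.eq, star_trivial], by simp [htr]⟩
  simp only [quadForm_smul, mul_pow, integral_const_mul] at hunit
  rwa [inv_pow, mul_left_comm, inv_mul_le_iff₀ (by positivity), mul_comm (‖A‖ ^ 2)] at hunit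

theorem exists_norm_linearization_le_mul :
    ∃ β : ℝ, 0 ≤ β ∧ β < 1 ∧ ∀ A : Matrix ι ι ℂ, A.IsHermitian → A.trace.re = 0 →
      ‖linearization μ z A‖ ≤ β * ‖A‖ := by
  obtain ⟨m, hm0, hm1, hm⟩ := hz.exists_integral_sq_quadForm_le_mul hb
  refine ⟨√m, Real.sqrt_nonneg m, (Real.sqrt_lt' one_pos).2 (by simpa using hm1),
    fun A hA htr => (sq_le_sq₀ (norm_nonneg _) (by positivity)).1 ?_⟩
  rw [mul_pow, Real.sq_sqrt hm0]
  exact (hz.norm_sq_linearization_le hb A).trans (hm A hA htr)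

end StableFrame

/-! ### Convergence when the identity is a fixed point -/

theorem tendsto_zero_of_le_mul_add_sub {e τ : ℕ → ℝ} {β : ℝ} (hβ : β < 1) (he : ∀ s, 0 ≤ e s)
    (hτ : ∀ s, 0 ≤ τ s) (hrec : ∀ s, e (s + 1) ≤ β * e s + (τ s - τ (s + 1))) :
    Tendsto e atTop (𝓝 0) := by
  have hdrop (s : ℕ) : (1 - β) * e s ≤ (e s + τ s) - (e (s + 1) + τ (s + 1)) := by
    linarith [hrec s]
  have hanti : Antitone fun s => e s + τ s := antitone_nat_of_succ_le fun s =>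
    sub_nonneg.1 ((mul_nonneg (sub_pos.2 hβ).le (he s)).trans (hdrop s))
  have hlim := tendsto_atTop_ciInf hanti
    ⟨0, Set.forall_mem_range.2 fun s => add_nonneg (he s) (hτ s)⟩
  have hdiff := (hlim.sub ((tendsto_add_atTop_iff_nat 1).2 hlim)).div_const (1 - β)
  rw [sub_self, zero_div] at hdiff
  refine squeeze_zero he (fun s => ?_) hdiff
  rw [le_div_iff₀' (sub_pos.2 hβ)]
  exact hdrop s

theorem exists_le_mul_pow_of_eventually_le_mul {e : ℕ → ℝ} {γ : ℝ} (hγ : 0 < γ)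
    (he : ∀ s, 0 ≤ e s) (hstep : ∀ᶠ s in atTop, e (s + 1) ≤ γ * e s) :
    ∃ C > 0, ∀ s, e s ≤ C * γ ^ s := by
  obtain ⟨N, hN⟩ := eventually_atTop.1 hstep
  have hbigO : e =O[atTop] fun s => γ ^ s := by
    refine .of_bound (e N / γ ^ N) (eventually_atTop.2 ⟨N, fun s hs => ?_⟩)
    obtain ⟨k, rfl⟩ := Nat.exists_eq_add_of_le hs
    have hgeom := le_geom (u := fun j => e (N + j)) hγ.le k fun j _ => hN (N + j) (by simp)
    rw [Real.norm_of_nonneg (he _), Real.norm_of_nonneg (by positivity), pow_add, ← mul_assoc,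
      div_mul_cancel₀ _ (by positivity), mul_comm]
    exact hgeom
  obtain ⟨C, hC, hle⟩ := Asymptotics.bound_of_isBigO_nat_atTop hbigO
  refine ⟨C, hC, fun s => ?_⟩
  simpa [abs_of_nonneg (he s), abs_of_pos hγ] using hle (pow_ne_zero s hγ.ne')

-- The recursion alone makes `e` tend to zero; once `e` is small, the quadratic bound turns the
-- additive error into a contribution to the contraction factor.
theorem exists_le_mul_pow_of_quadratic_drop {e τ : ℕ → ℝ} {β K : ℝ} (hβ0 : 0 ≤ β) (hβ1 : β < 1)
    (he : ∀ s, 0 ≤ e s) (hτ : ∀ s, 0 ≤ τ s) (hanti : ∀ s, τ (s + 1) ≤ τ s)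
    (hrec : ∀ s, e (s + 1) ≤ β * e s + 2 * (τ s - τ (s + 1)))
    (hquad : ∀ s, τ s - τ (s + 1) ≤ K * e s ^ 2) :
    ∃ τ' C γ : ℝ, 0 < C ∧ 0 < γ ∧ γ < 1 ∧ Tendsto τ atTop (𝓝 τ') ∧
      ∀ s, e s + |τ s - τ'| ≤ C * γ ^ s := by
  have helim : Tendsto e atTop (𝓝 0) :=
    tendsto_zero_of_le_mul_add_sub (τ := fun s => 2 * τ s) hβ1 he
      (fun s => mul_nonneg zero_le_two (hτ s)) fun s => by linarith [hrec s]
  obtain ⟨γ, hβγ, hγ1⟩ := exists_between hβ1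
  have hγ0 : 0 < γ := hβ0.trans_lt hβγ
  have hsmall : ∀ᶠ s in atTop, 2 * K * e s ≤ γ - β :=
    (helim.const_mul (2 * K)).eventually_le_const (by simpa using hβγ)
  have hcontract : ∀ᶠ s in atTop, e (s + 1) ≤ γ * e s := by
    filter_upwards [hsmall] with s hs
    linarith [hrec s, hquad s, mul_le_mul_of_nonneg_right hs (he s)]
  obtain ⟨C, hC, hgeom⟩ := exists_le_mul_pow_of_eventually_le_mul hγ0 he hcontract
  have hdist (s : ℕ) : dist (τ s) (τ (s + 1)) ≤ |K| * C ^ 2 * γ ^ s := by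
    rw [Real.dist_eq, abs_of_nonneg (sub_nonneg.2 (hanti s))]
    calc _ ≤ |K| * (C * γ ^ s) ^ 2 := (hquad s).trans
          (mul_le_mul (le_abs_self K) (pow_le_pow_left₀ (he s) (hgeom s) 2) (sq_nonneg _)
            (abs_nonneg K))
      _ = |K| * C ^ 2 * (γ ^ s * γ ^ s) := by ring
      _ ≤ |K| * C ^ 2 * γ ^ s := by
          gcongr
          exact mul_le_of_le_one_left (by positivity) (pow_le_one₀ hγ0.le hγ1.le)
  obtain ⟨τ', hlim⟩ := cauchySeq_tendsto_of_complete (cauchySeq_of_le_geometric _ _ hγ1 hdist)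
  refine ⟨τ', C + |K| * C ^ 2 / (1 - γ), γ, ?_, hγ0, hγ1, hlim, fun s => ?_⟩
  · have := sub_pos.2 hγ1
    positivity
  · rw [← Real.dist_eq, add_mul, div_mul_eq_mul_div]
    exact add_le_add (hgeom s) (dist_le_of_le_geometric_of_tendsto _ _ hγ1 hdist hlim s)

/-- The trace free part of a Hermitian matrix, its component orthogonal to the scalar matrices. -/
def tracelessPart (G : Matrix ι ι ℂ) : Matrix ι ι ℂ := G - (G.trace.re / card ι) • 1

omit [Fintype ι] in
theorem isHermitian_sub_smul_one {G : Matrix ι ι ℂ} (hG : G.IsHermitian) (c : ℝ) :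
    (G - c • (1 : Matrix ι ι ℂ)).IsHermitian :=
  hG.sub (by rw [IsHermitian, conjTranspose_smul, conjTranspose_one, star_trivial])

theorem re_trace_tracelessPart [Nonempty ι] (G : Matrix ι ι ℂ) :
    (tracelessPart G).trace.re = 0 := by
  simp [tracelessPart]

theorem norm_one_le_card : ‖(1 : Matrix ι ι ℂ)‖ ≤ card ι := by
  refine (sq_le_sq₀ (norm_nonneg _) (Nat.cast_nonneg _)).1 ?_
  rw [frobenius_norm_sq, conjTranspose_one, mul_one, trace_one, Complex.natCast_re]
  exact_mod_cast Nat.le_self_pow two_ne_zero _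

theorem mul_quadForm_inv_le {G : Matrix ι ι ℂ} (hG : G.PosDef) {l : ℝ} (hl : 0 ≤ l)
    (hlG : ∀ v, l * ‖toLp 2 v‖ ^ 2 ≤ quadForm G v) (v : ι → ℂ) :
    l * quadForm G⁻¹ v ≤ ‖toLp 2 v‖ ^ 2 := by
  have hdet : IsUnit G.det := (isUnit_iff_isUnit_det _).1 hG.isUnit
  have hform : quadForm G (G⁻¹ *ᵥ v) = quadForm G⁻¹ v := by
    rw [← quadForm_conj, hG.inv.1.eq, nonsing_inv_mul _ hdet, one_mul]
  have hnorm : quadForm (Gᴴ * G) (G⁻¹ *ᵥ v) = ‖toLp 2 v‖ ^ 2 := by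
    rw [quadForm_conjTranspose_mul_self, mulVec_mulVec, mul_nonsing_inv _ hdet, one_mulVec]
  have hsq := norm_sq_mulVec_sub_smul hG.1 l (G⁻¹ *ᵥ v)
  have hle := mul_le_mul_of_nonneg_left (hlG (G⁻¹ *ᵥ v)) hl
  rw [hform] at hsq hle
  rw [hnorm] at hsq
  linarith [sq_nonneg ‖toLp 2 (G *ᵥ G⁻¹ *ᵥ v - l • G⁻¹ *ᵥ v)‖]

/-- The gap `⟨G v, v⟩ - ⟨G⁻¹ v, v⟩⁻¹` in the Cauchy-Schwarz inequality
`1 ≤ ⟨G v, v⟩ ⟨G⁻¹ v, v⟩` for a unit vector `v`. It measures the failure of `frameMap` to agree with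
its linearisation. -/
def cauchySchwarzGap (G : Matrix ι ι ℂ) (v : ι → ℂ) : ℝ := quadForm G v - (quadForm G⁻¹ v)⁻¹

section CauchySchwarzGap

variable {G : Matrix ι ι ℂ} {v : ι → ℂ}

theorem quadForm_inv_mulVec_sub_quadForm_smul (hG : G.PosDef) (hv : ‖toLp 2 v‖ = 1) :
    quadForm G⁻¹ (G *ᵥ v - quadForm G v • v) =
      quadForm G v * (quadForm G v * quadForm G⁻¹ v - 1) := by
  have hdet : IsUnit G.det := (isUnit_iff_isUnit_det _).1 hG.isUnit
  have hcomm : Commute G G⁻¹ := by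
    rw [Commute, SemiconjBy, mul_nonsing_inv _ hdet, nonsing_inv_mul _ hdet]
  rw [quadForm_mulVec_sub_smul hG.1 hcomm, hG.1.eq, mul_nonsing_inv _ hdet, nonsing_inv_mul _ hdet,
    one_mul, quadForm_one, hv]
  ring

theorem one_le_quadForm_mul_quadForm_inv (hG : G.PosDef) (hv : ‖toLp 2 v‖ = 1) :
    1 ≤ quadForm G v * quadForm G⁻¹ v := by
  have hpos := quadForm_pos hG (ne_zero_of_norm_toLp_eq_one hv)
  have hres := quadForm_nonneg hG.inv (G *ᵥ v - quadForm G v • v)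
  rw [quadForm_inv_mulVec_sub_quadForm_smul hG hv] at hres
  exact sub_nonneg.1 (nonneg_of_mul_nonneg_right hres hpos)

theorem cauchySchwarzGap_nonneg (hG : G.PosDef) (hv : ‖toLp 2 v‖ = 1) :
    0 ≤ cauchySchwarzGap G v := by
  have hpos := quadForm_pos hG.inv (ne_zero_of_norm_toLp_eq_one hv)
  rw [cauchySchwarzGap, sub_nonneg, inv_eq_one_div, div_le_iff₀ hpos]
  exact one_le_quadForm_mul_quadForm_inv hG hv

theorem cauchySchwarzGap_le_quadForm_inv (hG : G.PosDef) (hv : ‖toLp 2 v‖ = 1) :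
    cauchySchwarzGap G v ≤ quadForm G⁻¹ (G *ᵥ v - quadForm G v • v) := by
  have hv0 := ne_zero_of_norm_toLp_eq_one hv
  have ha := quadForm_pos hG hv0
  have hb := quadForm_pos hG.inv hv0
  have hgap : cauchySchwarzGap G v =
      quadForm G⁻¹ (G *ᵥ v - quadForm G v • v) / (quadForm G v * quadForm G⁻¹ v) := by
    rw [quadForm_inv_mulVec_sub_quadForm_smul hG hv, cauchySchwarzGap]
    field_simp
  rw [hgap]
  exact div_le_self (quadForm_nonneg hG.inv _) (one_le_quadForm_mul_quadForm_inv hG hv)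

theorem norm_sq_mulVec_sub_quadForm_smul_le (hG : G.IsHermitian) (hv : ‖toLp 2 v‖ = 1) (c : ℝ) :
    ‖toLp 2 (G *ᵥ v - quadForm G v • v)‖ ^ 2 ≤ ‖G - c • (1 : Matrix ι ι ℂ)‖ ^ 2 := by
  set A := G - c • (1 : Matrix ι ι ℂ) with hA
  have hshift : G *ᵥ v - quadForm G v • v = A *ᵥ v - quadForm A v • v := by
    rw [hA, sub_mulVec, smul_mulVec, one_mulVec, quadForm_sub, quadForm_smul, quadForm_one, hv]
    module
  have hnorm : quadForm (Aᴴ * A) v ≤ ‖A‖ ^ 2 := by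
    rw [quadForm_conjTranspose_mul_self]
    gcongr
    simpa [hv] using norm_toLp_mulVec_le A v
  rw [hshift, norm_sq_mulVec_sub_quadForm_smul (isHermitian_sub_smul_one hG c) hv]
  linarith [sq_nonneg (quadForm A v)]

theorem cauchySchwarzGap_le (hG : G.PosDef) {l : ℝ} (hl : 0 < l)
    (hlG : ∀ v, l * ‖toLp 2 v‖ ^ 2 ≤ quadForm G v) (hv : ‖toLp 2 v‖ = 1) (c : ℝ) :
    cauchySchwarzGap G v ≤ l⁻¹ * ‖G - c • (1 : Matrix ι ι ℂ)‖ ^ 2 := by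
  refine (cauchySchwarzGap_le_quadForm_inv hG hv).trans ?_
  rw [inv_mul_eq_div, le_div_iff₀' hl]
  exact (mul_quadForm_inv_le hG hl.le hlG _).trans
    (norm_sq_mulVec_sub_quadForm_smul_le hG.1 hv c)

end CauchySchwarzGap

namespace UnitFrame

variable (hz : UnitFrame z) {G : Matrix ι ι ℂ}
include hz

theorem norm_frameOperator_cauchySchwarzGap_le (hG : G.PosDef) :
    ‖frameOperator μ z fun x => cauchySchwarzGap G (z x)‖ ≤
      card ι * ∫ x, cauchySchwarzGap G (z x) ∂μ := by
  simpa only [abs_of_nonneg (cauchySchwarzGap_nonneg hG (hz.norm_eq_one _))] using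
    hz.norm_frameOperator_le (μ := μ) fun x => cauchySchwarzGap G (z x)

section FiniteMeasure

variable [IsFiniteMeasure μ]

theorem integrable_cauchySchwarzGap (hG : G.PosDef) :
    Integrable (fun x => cauchySchwarzGap G (z x)) μ :=
  (hz.integrable_quadForm G).sub (hz.integrable_inv_quadForm hG.inv)

theorem frameMap_eq_linearization_sub (hG : G.PosDef) :
    frameMap μ z G =
      linearization μ z G - frameOperator μ z fun x => cauchySchwarzGap G (z x) := by
  rw [linearization,
    ← hz.frameOperator_sub (hz.integrable_quadForm G) (hz.integrable_cauchySchwarzGap hG)]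
  simp only [cauchySchwarzGap, sub_sub_cancel, frameMap]

variable (hb : frameOperator μ z 1 = 1)
include hb

theorem linearization_tracelessPart (G : Matrix ι ι ℂ) :
    linearization μ z (tracelessPart G) =
      linearization μ z G - (G.trace.re / card ι) • (1 : Matrix ι ι ℂ) := by
  have hone := frameOperator_const_mul (μ := μ) (z := z) (G.trace.re / card ι) 1
  rw [hb] at hone
  simp only [linearization, tracelessPart, quadForm_sub, quadForm_smul, hz.quadForm_one_eq_one]
  rw [← hone]
  exact hz.frameOperator_sub (hz.integrable_quadForm G) (integrable_const _)

theorem trace_sub_trace_frameMap (hG : G.PosDef) :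
    G.trace.re - (frameMap μ z G).trace.re = card ι * ∫ x, cauchySchwarzGap G (z x) ∂μ := by
  simp only [cauchySchwarzGap]
  rw [integral_sub (hz.integrable_quadForm G) (hz.integrable_inv_quadForm hG.inv), mul_sub,
    hz.integral_quadForm_of_balanced hb, frameMap,
    hz.re_trace_frameOperator (hz.integrable_inv_quadForm hG.inv)]

theorem trace_frameMap_le (hG : G.PosDef) : (frameMap μ z G).trace.re ≤ G.trace.re := by
  rw [← sub_nonneg, hz.trace_sub_trace_frameMap hb hG]
  exact mul_nonneg (Nat.cast_nonneg _)
    (integral_nonneg fun x => cauchySchwarzGap_nonneg hG (hz.norm_eq_one x))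

theorem le_quadForm_frameMap (hG : G.PosDef) {l : ℝ} (hl : 0 < l)
    (hlG : ∀ v, l * ‖toLp 2 v‖ ^ 2 ≤ quadForm G v) (v : ι → ℂ) :
    l * ‖toLp 2 v‖ ^ 2 ≤ quadForm (frameMap μ z G) v := by
  have hnorm : ‖toLp 2 v‖ ^ 2 = card ι * ∫ x, quadForm (outer v) (z x) ∂μ := by
    rw [hz.integral_quadForm_of_balanced hb, ← quadForm_one, quadForm_eq_re_trace, one_mul]
  have hweight (x : X) : l ≤ (quadForm G⁻¹ (z x))⁻¹ := by
    have hle := mul_quadForm_inv_le hG hl.le hlG (z x)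
    rw [hz.norm_eq_one, one_pow] at hle
    rwa [inv_eq_one_div, le_div_iff₀ (hz.quadForm_pos hG.inv x)]
  rw [hz.quadForm_frameMap hG, hnorm, mul_left_comm, ← integral_const_mul]
  simp only [← quadForm_outer]
  refine mul_le_mul_of_nonneg_left (integral_mono ((hz.integrable_quadForm _).const_mul l)
    (hz.integrable_mul_quadForm (hz.integrable_inv_quadForm hG.inv) _) fun x => ?_)
    (Nat.cast_nonneg _)
  refine mul_le_mul_of_nonneg_right (hweight x) ?_
  rw [quadForm_outer]
  positivity

theorem norm_tracelessPart_frameMap_le [Nonempty ι] {β : ℝ}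
    (hβ : ∀ A : Matrix ι ι ℂ, A.IsHermitian → A.trace.re = 0 →
      ‖linearization μ z A‖ ≤ β * ‖A‖) (hG : G.PosDef) :
    ‖tracelessPart (frameMap μ z G)‖ ≤
      β * ‖tracelessPart G‖ + 2 * (G.trace.re - (frameMap μ z G).trace.re) := by
  set drop := G.trace.re - (frameMap μ z G).trace.re with hdrop
  have hsplit : tracelessPart (frameMap μ z G) = linearization μ z (tracelessPart G) +
      (drop / card ι) • (1 : Matrix ι ι ℂ) -
        frameOperator μ z fun x => cauchySchwarzGap G (z x) := by
    rw [hz.linearization_tracelessPart hb, tracelessPart, hdrop, sub_div,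
      hz.frameMap_eq_linearization_sub hG]
    module
  have hscalar : ‖(drop / card ι) • (1 : Matrix ι ι ℂ)‖ ≤ drop := by
    rw [norm_smul, norm_div, Real.norm_natCast,
      Real.norm_of_nonneg (sub_nonneg.2 (hz.trace_frameMap_le hb hG)), div_mul_eq_mul_div]
    exact div_le_of_le_mul₀ (Nat.cast_nonneg _) (sub_nonneg.2 (hz.trace_frameMap_le hb hG))
      (by gcongr; exacts [sub_nonneg.2 (hz.trace_frameMap_le hb hG), norm_one_le_card])
  have hgap : ‖frameOperator μ z fun x => cauchySchwarzGap G (z x)‖ ≤ drop :=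
    (hz.norm_frameOperator_cauchySchwarzGap_le hG).trans_eq
      (hz.trace_sub_trace_frameMap hb hG).symm
  calc _ ≤ ‖linearization μ z (tracelessPart G)‖ + ‖(drop / card ι) • (1 : Matrix ι ι ℂ)‖ +
        ‖frameOperator μ z fun x => cauchySchwarzGap G (z x)‖ := by
        rw [hsplit]
        exact (norm_sub_le _ _).trans (by gcongr; exact norm_add_le _ _)
    _ ≤ β * ‖tracelessPart G‖ + drop + drop := by
        gcongr
        exact hβ _ (isHermitian_sub_smul_one hG.1 _) (re_trace_tracelessPart G)
    _ = _ := by ring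

end FiniteMeasure

section ProbabilityMeasure

variable [IsProbabilityMeasure μ] (hb : frameOperator μ z 1 = 1)
include hb

theorem card_mul_le_trace {l : ℝ}
    (hlG : ∀ v, l * ‖toLp 2 v‖ ^ 2 ≤ quadForm G v) : card ι * l ≤ G.trace.re := by
  rw [← hz.integral_quadForm_of_balanced hb]
  gcongr
  simpa using integral_mono (integrable_const (μ := μ) l) (hz.integrable_quadForm G)
    fun x => by simpa [hz.norm_eq_one] using hlG (z x)

theorem trace_sub_trace_frameMap_le (hG : G.PosDef) {l : ℝ} (hl : 0 < l)
    (hlG : ∀ v, l * ‖toLp 2 v‖ ^ 2 ≤ quadForm G v) :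
    G.trace.re - (frameMap μ z G).trace.re ≤ card ι * l⁻¹ * ‖tracelessPart G‖ ^ 2 := by
  rw [hz.trace_sub_trace_frameMap hb hG, mul_assoc]
  gcongr
  simpa [tracelessPart] using
    integral_mono (hz.integrable_cauchySchwarzGap (μ := μ) hG) (integrable_const _)
    fun x => cauchySchwarzGap_le hG hl hlG (hz.norm_eq_one x) (G.trace.re / card ι)

end ProbabilityMeasure

end UnitFrame

namespace StableFrame

variable [IsProbabilityMeasure μ] [Nonempty ι] (hz : StableFrame μ z) {G : Matrix ι ι ℂ}
  (hG : G.PosDef)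
include hz hG

theorem posDef_iterate_frameMap (r : ℕ) : ((frameMap μ z)^[r] G).PosDef := by
  induction r with
  | zero => exact hG
  | succ r ih =>
    rw [Function.iterate_succ_apply']
    exact hz.posDef_frameMap ih

theorem le_quadForm_iterate_frameMap (hb : frameOperator μ z 1 = 1) {l : ℝ} (hl : 0 < l)
    (hlG : ∀ v, l * ‖toLp 2 v‖ ^ 2 ≤ quadForm G v) (r : ℕ) :
    ∀ v, l * ‖toLp 2 v‖ ^ 2 ≤ quadForm ((frameMap μ z)^[r] G) v := by
  induction r with
  | zero => exact hlG
  | succ r ih =>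
    rw [Function.iterate_succ_apply']
    exact hz.le_quadForm_frameMap hb (hz.posDef_iterate_frameMap hG r) hl ih

theorem exists_norm_iterate_sub_smul_one_le (hb : frameOperator μ z 1 = 1) :
    ∃ c C γ : ℝ, 0 < c ∧ 0 < C ∧ 0 < γ ∧ γ < 1 ∧
      ∀ r : ℕ, ‖(frameMap μ z)^[r] G - c • (1 : Matrix ι ι ℂ)‖ ≤ C * γ ^ r := by
  obtain ⟨β, hβ0, hβ1, hβ⟩ := hz.exists_norm_linearization_le_mul hb
  obtain ⟨l, hl, hlG⟩ := exists_mul_norm_sq_le_quadForm hG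
  set g : ℕ → Matrix ι ι ℂ := fun r => (frameMap μ z)^[r] G
  have hgsucc (r : ℕ) : g (r + 1) = frameMap μ z (g r) := Function.iterate_succ_apply' _ _ _
  have hgpos (r : ℕ) : (g r).PosDef := hz.posDef_iterate_frameMap hG r
  have hgl (r : ℕ) := hz.le_quadForm_iterate_frameMap hG hb hl hlG r
  have htrace (r : ℕ) : card ι * l ≤ (g r).trace.re := hz.card_mul_le_trace hb (hgl r)
  obtain ⟨τ, C, γ, hC, hγ0, hγ1, hlim, hbound⟩ := exists_le_mul_pow_of_quadratic_drop
    (e := fun r => ‖tracelessPart (g r)‖) (τ := fun r => (g r).trace.re) hβ0 hβ1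
    (fun r => norm_nonneg _) (fun r => (by positivity : 0 ≤ card ι * l).trans (htrace r))
    (fun r => hgsucc r ▸ hz.trace_frameMap_le hb (hgpos r))
    (fun r => hgsucc r ▸ hz.norm_tracelessPart_frameMap_le hb hβ (hgpos r))
    (fun r => hgsucc r ▸ hz.trace_sub_trace_frameMap_le hb (hgpos r) hl (hgl r))
  have hτ : 0 < τ := (by positivity : 0 < card ι * l).trans_le (ge_of_tendsto' hlim htrace)
  refine ⟨τ / card ι, C, γ, by positivity, hC, hγ0, hγ1, fun r => ?_⟩
  have hsplit : g r - (τ / card ι) • (1 : Matrix ι ι ℂ) =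
      tracelessPart (g r) + (((g r).trace.re - τ) / card ι) • (1 : Matrix ι ι ℂ) := by
    rw [tracelessPart, sub_div]
    module
  have hscalar : ‖(((g r).trace.re - τ) / card ι) • (1 : Matrix ι ι ℂ)‖ ≤
      |(g r).trace.re - τ| := by
    rw [norm_smul, norm_div, Real.norm_natCast, Real.norm_eq_abs, div_mul_eq_mul_div]
    exact div_le_of_le_mul₀ (Nat.cast_nonneg _) (abs_nonneg _)
      (by gcongr; exact norm_one_le_card)
  calc ‖g r - (τ / card ι) • (1 : Matrix ι ι ℂ)‖
      ≤ ‖tracelessPart (g r)‖ + |(g r).trace.re - τ| := by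
        rw [hsplit]
        exact (norm_add_le _ _).trans (by gcongr)
    _ ≤ C * γ ^ r := hbound r

end StableFrame

/-! ### Coercivity -/

theorem continuous_conjDiag :
    Continuous fun p : Matrix ι ι ℂ × (ι → ℝ) => conjDiag p.1 p.2 := by
  have hdiag : Continuous fun d : ι → ℝ => diagonal fun i => (d i : ℂ) :=
    Continuous.matrix_diagonal (by fun_prop)
  exact (continuous_fst.mul (hdiag.comp continuous_snd)).mul (continuous_star.comp continuous_fst)

theorem isCompact_unitaryGroup : IsCompact (unitaryGroup ι ℂ : Set (Matrix ι ι ℂ)) := by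
  refine Metric.isCompact_of_isClosed_isBounded ?_
    (isBounded_iff_forall_norm_le.2 ⟨‖(1 : Matrix ι ι ℂ)‖, fun U hU => ?_⟩)
  · have hset : (unitaryGroup ι ℂ : Set (Matrix ι ι ℂ)) = {U | U * star U = 1} :=
      Set.ext fun U => mem_unitaryGroup_iff
    rw [hset]
    exact isClosed_eq (continuous_id.mul continuous_star) continuous_const
  · refine (sq_le_sq₀ (norm_nonneg _) (norm_nonneg _)).1 (le_of_eq ?_)
    rw [frobenius_norm_sq, frobenius_norm_sq, conjTranspose_mul_self_of_mem_unitaryGroup hU,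
      conjTranspose_one, mul_one]

/-- For unitary `U`, the squared norm of the orthogonal projection of `v` to the span of the columns
of `U` with index in `s`. -/
def columnMass (U : Matrix ι ι ℂ) (s : Finset ι) (v : ι → ℂ) : ℝ := ∑ i ∈ s, ‖(Uᴴ *ᵥ v) i‖ ^ 2

theorem columnMass_eq_quadForm (U : Matrix ι ι ℂ) (s : Finset ι) (v : ι → ℂ) :
    columnMass U s v = quadForm (conjDiag U fun i => if i ∈ s then 1 else 0) v := by
  simp [columnMass, quadForm_conjDiag]

theorem mul_columnMass_le_quadForm_conjDiag (U : Matrix ι ι ℂ) {s : Finset ι} {d : ι → ℝ}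
    (hd : ∀ i, 0 ≤ d i) {c : ℝ} (hc : ∀ i ∈ s, c ≤ d i) (v : ι → ℂ) :
    c * columnMass U s v ≤ quadForm (conjDiag U d) v := by
  rw [quadForm_conjDiag, columnMass, Finset.mul_sum]
  calc ∑ i ∈ s, c * ‖(Uᴴ *ᵥ v) i‖ ^ 2 ≤ ∑ i ∈ s, d i * ‖(Uᴴ *ᵥ v) i‖ ^ 2 :=
        Finset.sum_le_sum fun i hi => by gcongr; exact hc i hi
    _ ≤ ∑ i, d i * ‖(Uᴴ *ᵥ v) i‖ ^ 2 :=
        Finset.sum_le_univ_sum_of_nonneg fun i => mul_nonneg (hd i) (sq_nonneg _)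

/-- The vectors orthogonal to the columns of `U` with index in `s`. -/
def orthCols (U : Matrix ι ι ℂ) (s : Finset ι) : Submodule ℂ (ι → ℂ) :=
  LinearMap.ker (LinearMap.funLeft ℂ ℂ (Subtype.val : s → ι) ∘ₗ mulVecLin Uᴴ)

omit [DecidableEq ι] in
theorem mem_orthCols_iff {U : Matrix ι ι ℂ} {s : Finset ι} {v : ι → ℂ} :
    v ∈ orthCols U s ↔ columnMass U s v ≤ 0 := by
  have hnonneg : 0 ≤ columnMass U s v := Finset.sum_nonneg fun i _ => sq_nonneg _
  rw [hnonneg.ge_iff_eq', columnMass, Finset.sum_eq_zero_iff_of_nonneg fun i _ => sq_nonneg _,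
    orthCols, LinearMap.mem_ker, funext_iff]
  simp [LinearMap.funLeft_apply]

theorem finrank_orthCols {U : Matrix ι ι ℂ} (hU : U ∈ unitaryGroup ι ℂ) (s : Finset ι) :
    finrank ℂ (orthCols U s) + s.card = card ι := by
  set f := LinearMap.funLeft ℂ ℂ (Subtype.val : s → ι) ∘ₗ mulVecLin Uᴴ with hf
  have hsurj : Function.Surjective f := by
    rw [hf, LinearMap.coe_comp]
    exact (LinearMap.funLeft_surjective_of_injective ℂ ℂ _ Subtype.val_injective).comp fun v =>
      ⟨U *ᵥ v, by simp [conjTranspose_mul_self_of_mem_unitaryGroup hU]⟩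
  have hrank := f.finrank_range_add_finrank_ker
  rw [LinearMap.range_eq_top.2 hsurj, finrank_top, Module.finrank_fintype_fun_eq_card,
    Module.finrank_fintype_fun_eq_card, Fintype.card_coe] at hrank
  rw [orthCols, ← hf, add_comm, hrank]

theorem tendsto_measureReal_lt_nhdsGT [IsFiniteMeasure μ] {f : X → ℝ} (hf : Measurable f) (a : ℝ) :
    Tendsto (fun t => μ.real {x | f x < t}) (𝓝[>] a) (𝓝 (μ.real {x | f x ≤ a})) := by
  have hInter : ⋂ t > a, {x | f x < t} = {x | f x ≤ a} := by
    ext x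
    simp only [Set.mem_iInter, Set.mem_ofPred_eq]
    exact ⟨le_of_forall_gt, fun hx t ht => hx.trans_lt ht⟩
  have hlim := tendsto_measure_biInter_gt (μ := μ) (a := a) (s := fun t => {x | f x < t})
    (fun t _ => (measurableSet_lt hf measurable_const).nullMeasurableSet)
    (fun t u _ htu x (hx : f x < t) => hx.trans_le htu) ⟨a + 1, by simp, measure_ne_top _ _⟩
  rw [hInter] at hlim
  exact (ENNReal.tendsto_toReal (measure_ne_top μ _)).comp hlim

omit [DecidableEq ι] in
theorem UnitFrame.measurable_columnMass (hz : UnitFrame z) (U : Matrix ι ι ℂ) (s : Finset ι) :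
    Measurable fun x => columnMass U s (z x) := by
  classical
  simpa only [columnMass_eq_quadForm] using hz.measurable_quadForm _

namespace StableFrame

section

variable [Nonempty ι] (hz : StableFrame μ z) {s : Finset ι} (hs : s.Nonempty)
  (hs' : s ≠ Finset.univ) {U : Matrix ι ι ℂ} (hU : U ∈ unitaryGroup ι ℂ)
include hz hs hs' hU

theorem measure_columnMass_nonpos_lt :
    μ.real {x | columnMass U s (z x) ≤ 0} < 1 - s.card / card ι := by
  have hrank := finrank_orthCols hU s
  have hpos := hs.card_pos
  have hlt := s.card_lt_iff_ne_univ.2 hs'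
  have hbot : orthCols U s ≠ ⊥ := fun h => by
    rw [h, finrank_bot] at hrank
    lia
  have htop : orthCols U s ≠ ⊤ := fun h => by
    rw [h, finrank_top, Module.finrank_fintype_fun_eq_card] at hrank
    lia
  have hratio : (finrank ℂ (orthCols U s) : ℝ) / card ι = 1 - s.card / card ι := by
    rw [eq_sub_iff_add_eq, ← add_div, div_eq_one_iff_eq (by positivity)]
    exact_mod_cast hrank
  simpa only [← mem_orthCols_iff, hratio] using hz.measure_mem_lt _ hbot htop

theorem eventually_measure_columnMass_le [IsFiniteMeasure μ] :
    ∀ᶠ p : ℝ × Matrix ι ι ℂ in 𝓝 (0, U),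
      μ.real {x | columnMass p.2 s (z x) < p.1} ≤ 1 - s.card / card ι - p.1 := by
  obtain ⟨ε, hlt, hε : 0 < ε⟩ :=
    (((tendsto_measureReal_lt_nhdsGT (hz.measurable_columnMass U s) 0).eventually_lt_const
      (hz.measure_columnMass_nonpos_lt hs hs' hU)).and self_mem_nhdsWithin).exists
  let proj : Matrix ι ι ℂ → Matrix ι ι ℂ := fun V => conjDiag V fun i => if i ∈ s then 1 else 0
  have hproj : Continuous fun p : ℝ × Matrix ι ι ℂ => ‖proj U - proj p.2‖ :=
    (continuous_const.sub
      (continuous_conjDiag.comp (continuous_snd.prodMk continuous_const))).norm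
  have hnear : ∀ᶠ p : ℝ × Matrix ι ι ℂ in 𝓝 (0, U), ‖proj U - proj p.2‖ < ε / 2 :=
    hproj.continuousAt.eventually_lt_const (by simpa using hε)
  have hfst (δ : ℝ) (hδ : 0 < δ) : ∀ᶠ p : ℝ × Matrix ι ι ℂ in 𝓝 (0, U), p.1 < δ :=
    continuous_fst.continuousAt.eventually_lt_const hδ
  filter_upwards [hfst _ (half_pos hε), hfst _ (sub_pos.2 hlt), hnear] with p hpε hplt hpU
  have hsub : {x | columnMass p.2 s (z x) < p.1} ⊆ {x | columnMass U s (z x) < ε} := by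
    intro x (hx : columnMass p.2 s (z x) < p.1)
    have hdiff := (le_abs_self _).trans (hz.abs_quadForm_le_norm (proj U - proj p.2) x)
    rw [quadForm_sub, ← columnMass_eq_quadForm, ← columnMass_eq_quadForm] at hdiff
    simp only [Set.mem_ofPred_eq]
    linarith
  linarith [measureReal_mono hsub (measure_ne_top μ _)]

end

theorem exists_uniform_measure_columnMass_le [IsFiniteMeasure μ] [Nonempty ι]
    (hz : StableFrame μ z) : ∃ ε > 0, ε ≤ 1 ∧ ∀ U ∈ unitaryGroup ι ℂ,
      ∀ s : Finset ι, s.Nonempty → s ≠ Finset.univ →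
        μ.real {x | columnMass U s (z x) < ε} ≤ 1 - s.card / card ι - ε := by
  have hall : ∀ᶠ ε : ℝ in 𝓝 0, ∀ s : Finset ι, s.Nonempty → s ≠ Finset.univ →
      ∀ U ∈ (unitaryGroup ι ℂ : Set (Matrix ι ι ℂ)),
        μ.real {x | columnMass U s (z x) < ε} ≤ 1 - s.card / card ι - ε := by
    refine eventually_all.2 fun s => eventually_imp_distrib_left.2 fun hs =>
      eventually_imp_distrib_left.2 fun hs' => ?_
    exact isCompact_unitaryGroup.eventually_forall_of_forall_eventually fun U hU =>
      hz.eventually_measure_columnMass_le hs hs' hU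
  obtain ⟨ε, ⟨hε, hle⟩, hpos⟩ := (((hall.and (eventually_le_nhds one_pos)).filter_mono
    nhdsWithin_le_nhds).and (self_mem_nhdsWithin (s := Set.Ioi (0 : ℝ)))).exists
  exact ⟨ε, hpos, hle, fun U hU s hs hs' => hε s hs hs' U hU⟩

end StableFrame

theorem exists_add_sum_ite_le {m : ℕ} {b S : ℕ → ℝ} {ε : ℝ} (hb : Antitone b) (hS : ε ≤ S m) :
    ∃ j ≤ m, ε ≤ S j ∧
      b 0 + ∑ i ∈ Finset.range m, (if S i < ε then b (i + 1) - b i else 0) ≤ b j := by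
  have hex : ∃ j, ε ≤ S j := ⟨m, hS⟩
  have hle : Nat.find hex ≤ m := Nat.find_min' hex hS
  refine ⟨Nat.find hex, hle, Nat.find_spec hex, ?_⟩
  have hbefore : ∑ i ∈ Finset.range (Nat.find hex), (if S i < ε then b (i + 1) - b i else 0) =
      b (Nat.find hex) - b 0 := by
    rw [← Finset.sum_range_sub]
    refine Finset.sum_congr rfl fun i hi => if_pos ?_
    exact not_le.1 (Nat.find_min hex (Finset.mem_range.1 hi))
  have hafter : ∑ i ∈ Finset.Ico (Nat.find hex) m, (if S i < ε then b (i + 1) - b i else 0) ≤ 0 :=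
    Finset.sum_nonpos fun i _ => by
      split_ifs
      exacts [sub_nonpos.2 (hb i.le_succ), le_rfl]
  rw [← Finset.sum_range_add_sum_Ico _ hle, hbefore]
  linarith

theorem add_sum_mul_sub_eq_mean_add (b : ℕ → ℝ) (δ : ℝ) (m : ℕ) :
    b 0 + ∑ j ∈ Finset.range m, (1 - (j + 1 : ℕ) / (m + 1 : ℕ) - δ) * (b (j + 1) - b j) =
      (∑ j ∈ Finset.range (m + 1), b j) / (m + 1 : ℕ) + δ * (b 0 - b m) := by
  have hparts := Finset.sum_range_by_parts b (fun _ => (1 : ℝ)) (m + 1)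
  simp only [smul_eq_mul, mul_one, Finset.sum_const, Finset.card_range, nsmul_eq_mul,
    Nat.add_sub_cancel] at hparts
  have hsplit : ∑ j ∈ Finset.range m, (1 - (j + 1 : ℕ) / (m + 1 : ℕ) - δ) * (b (j + 1) - b j) =
      (1 - δ) * (b m - b 0) -
        (∑ j ∈ Finset.range m, (b (j + 1) - b j) * (j + 1 : ℕ)) / (m + 1 : ℕ) := by
    rw [← Finset.sum_range_sub, Finset.mul_sum, Finset.sum_div, ← Finset.sum_sub_distrib]
    exact Finset.sum_congr rfl fun j _ => by ring
  rw [hsplit, hparts]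
  field_simp
  ring

-- Pointwise, `f` is at least `b 0` plus the sum of the decrements `b (j + 1) - b j` over those `j`
-- for which `S j` has not yet reached `ε`; integrate and sum by parts.
theorem mean_add_mul_sub_le_integral [IsProbabilityMeasure μ] {m : ℕ} {b : ℕ → ℝ}
    (hb : Antitone b) {S : ℕ → X → ℝ} (hS : ∀ j, Measurable (S j)) {ε : ℝ}
    (hSm : ∀ x, ε ≤ S m x)
    (hμ : ∀ j < m, μ.real {x | S j x < ε} ≤ 1 - (j + 1 : ℕ) / (m + 1 : ℕ) - ε)
    {f : X → ℝ} (hf : Integrable f μ) (hbf : ∀ x, ∀ j ≤ m, ε ≤ S j x → b j ≤ f x) :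
    (∑ j ∈ Finset.range (m + 1), b j) / (m + 1 : ℕ) + ε * (b 0 - b m) ≤ ∫ x, f x ∂μ := by
  let step : ℕ → X → ℝ := fun j => {x | S j x < ε}.indicator fun _ => b (j + 1) - b j
  have hmeas (j : ℕ) : MeasurableSet {x | S j x < ε} := measurableSet_lt (hS j) measurable_const
  have hstep (j : ℕ) : Integrable (step j) μ := (integrable_const _).indicator (hmeas j)
  have hsum : Integrable (fun x => ∑ j ∈ Finset.range m, step j x) μ :=
    integrable_finsetSum _ fun j _ => hstep j
  have hpoint (x : X) : b 0 + ∑ j ∈ Finset.range m, step j x ≤ f x := by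
    obtain ⟨j, hj, hSj, hle⟩ := exists_add_sum_ite_le (S := fun j => S j x) hb (hSm x)
    exact le_trans hle (hbf x j hj hSj)
  rw [← add_sum_mul_sub_eq_mean_add]
  calc b 0 + ∑ j ∈ Finset.range m, (1 - (j + 1 : ℕ) / (m + 1 : ℕ) - ε) * (b (j + 1) - b j)
      ≤ b 0 + ∑ j ∈ Finset.range m, μ.real {x | S j x < ε} * (b (j + 1) - b j) := by
        gcongr b 0 + ?_
        exact Finset.sum_le_sum fun j hj => mul_le_mul_of_nonpos_right
          (hμ j (Finset.mem_range.1 hj)) (sub_nonpos.2 (hb j.le_succ))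
    _ = ∫ x, (b 0 + ∑ j ∈ Finset.range m, step j x) ∂μ := by
        rw [integral_add (integrable_const _) hsum, integral_finsetSum _ fun j _ => hstep j]
        simp only [step, integral_indicator_const _ (hmeas _), integral_const, probReal_univ,
          one_mul, smul_eq_mul]
    _ ≤ ∫ x, f x ∂μ := integral_mono ((integrable_const _).add hsum) hf hpoint

omit [DecidableEq ι] in
theorem exists_equiv_antitone_comp (f : ι → ℝ) {m : ℕ} (hm : card ι = m) :
    ∃ σ : Fin m ≃ ι, Antitone (f ∘ σ) := by
  let e := (Fintype.equivFinOfCardEq hm).symm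
  refine ⟨(Tuple.sort fun i => -f (e i)).trans e, fun i j hij => ?_⟩
  exact neg_le_neg_iff.1 (Tuple.monotone_sort (fun i => -f (e i)) hij)

omit [DecidableEq ι] in
theorem exists_antitone_enumeration (f : ι → ℝ) {m : ℕ} (hm : card ι = m + 1) :
    ∃ (b : ℕ → ℝ) (s : ℕ → Finset ι), Antitone b ∧ (∀ j ≤ m, (s j).card = j + 1) ∧
      (∀ j, ∀ i ∈ s j, b j ≤ f i) ∧ ∑ j ∈ Finset.range (m + 1), b j = ∑ i, f i ∧
      ∀ i, b m ≤ f i ∧ f i ≤ b 0 := by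
  obtain ⟨σ, hσ⟩ := exists_equiv_antitone_comp f hm
  refine ⟨fun j => f (σ (Fin.clamp j m)),
    fun j => (Finset.Iic (Fin.clamp j m)).map σ.toEmbedding,
    fun i j hij => hσ (Fin.clamp_monotone hij), fun j hj => by simp [hj], fun j i hi => ?_, ?_,
    fun i => ⟨?_, ?_⟩⟩
  · obtain ⟨k, hk, rfl⟩ := Finset.mem_map.1 hi
    exact hσ (Finset.mem_Iic.1 hk)
  · rw [Finset.sum_range, ← σ.sum_comp f]
    refine Finset.sum_congr rfl fun i _ => ?_
    have hi : Fin.clamp i m = i := Fin.ext (by simpa using Nat.lt_succ_iff.1 i.2)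
    rw [hi]
  · simpa using hσ (a := σ.symm i) (b := Fin.clamp m m)
      (by simpa [Fin.le_def] using Nat.lt_succ_iff.1 (σ.symm i).2)
  · simpa using hσ (a := Fin.clamp 0 m) (b := σ.symm i) (by simp [Fin.le_def])

omit [DecidableEq ι] in
theorem UnitFrame.integrable_log_quadForm [IsFiniteMeasure μ] (hz : UnitFrame z)
    {H : Matrix ι ι ℂ} (hH : H.PosDef) : Integrable (fun x => Real.log (quadForm H (z x))) μ := by
  obtain ⟨c, hc, hle⟩ := hz.exists_le_quadForm hH
  refine .of_mem_Icc (Real.log c) (Real.log ‖H‖)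
    (Real.measurable_log.comp (hz.measurable_quadForm H)).aemeasurable
    (.of_forall fun x => ⟨?_, ?_⟩)
  · exact Real.log_le_log hc (hle x)
  · exact Real.log_le_log (hz.quadForm_pos hH x)
      ((le_abs_self _).trans (hz.abs_quadForm_le_norm H x))

theorem UnitFrame.log_add_mean_add_mul_sub_le_integral_log [IsProbabilityMeasure μ]
    (hz : UnitFrame z) {U : Matrix ι ι ℂ} (hU : U ∈ unitaryGroup ι ℂ) {ε : ℝ} (hε : 0 < ε)
    (hε1 : ε ≤ 1) (hstable : ∀ s : Finset ι, s.Nonempty → s ≠ Finset.univ →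
      μ.real {x | columnMass U s (z x) < ε} ≤ 1 - s.card / card ι - ε)
    {d : ι → ℝ} (hd : ∀ i, 0 < d i) (p q : ι) :
    Real.log ε + (∑ i, Real.log (d i)) / card ι + ε * (Real.log (d p) - Real.log (d q)) ≤
      ∫ x, Real.log (quadForm (conjDiag U d) (z x)) ∂μ := by
  obtain ⟨m, hm⟩ : ∃ m, card ι = m + 1 :=
    Nat.exists_eq_succ_of_ne_zero (Fintype.card_pos_iff.2 ⟨p⟩).ne'
  obtain ⟨b, s, hb, hcard, hbs, hsum, hends⟩ :=
    exists_antitone_enumeration (fun i => Real.log (d i)) hm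
  have hlast : s m = Finset.univ := Finset.eq_univ_of_card _ (by rw [hcard m le_rfl, hm])
  have hint := hz.integrable_log_quadForm (μ := μ) (posDef_conjDiag hU hd)
  have hpoint (x : X) (j : ℕ) (hj : ε ≤ columnMass U (s j) (z x)) :
      b j ≤ Real.log (quadForm (conjDiag U d) (z x)) - Real.log ε := by
    have hle : Real.exp (b j) * ε ≤ quadForm (conjDiag U d) (z x) :=
      (mul_le_mul_of_nonneg_left hj (Real.exp_pos _).le).trans
        (mul_columnMass_le_quadForm_conjDiag U (fun i => (hd i).le)
          (fun i hi => (Real.le_log_iff_exp_le (hd i)).1 (hbs j i hi)) _)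
    have hlog := Real.log_le_log (by positivity) hle
    rw [Real.log_mul (Real.exp_ne_zero _) hε.ne', Real.log_exp] at hlog
    exact le_sub_iff_add_le.2 hlog
  have hmean := mean_add_mul_sub_le_integral (μ := μ) (m := m) (ε := ε) hb
    (fun j => hz.measurable_columnMass U (s j))
    (fun x => by
      rwa [hlast, columnMass, sum_norm_sq_conjTranspose_mulVec hU, hz.norm_eq_one, one_pow])
    (fun j hj => by
      have hj' := hcard j hj.le
      rw [← hj', ← hm]
      exact hstable _ (Finset.card_pos.1 (by lia)) ((s j).card_lt_iff_ne_univ.1 (by lia)))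
    (hint.sub (integrable_const (Real.log ε))) fun x j _ hj => hpoint x j hj
  simp only [Pi.sub_apply] at hmean
  rw [hsum, ← hm, integral_sub hint (integrable_const _), integral_const, probReal_univ,
    one_smul] at hmean
  have hpq : ε * (Real.log (d p) - Real.log (d q)) ≤ ε * (b 0 - b m) := by
    gcongr
    exacts [(hends p).2, (hends q).1]
  linarith

/-! ### The potential and its minimiser -/

theorem re_det_pos {A : Matrix ι ι ℂ} (hA : A.PosDef) : 0 < A.det.re :=
  (Complex.pos_iff.1 hA.det_pos).1

theorem ofReal_re_det {A : Matrix ι ι ℂ} (hA : A.PosDef) : (A.det.re : ℂ) = A.det :=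
  Complex.ext rfl (Complex.pos_iff.1 hA.det_pos).2

theorem log_re_det_inv {A : Matrix ι ι ℂ} (hA : A.PosDef) :
    Real.log A⁻¹.det.re = -Real.log A.det.re := by
  rw [det_nonsing_inv, Ring.inverse_eq_inv', ← ofReal_re_det hA, ← Complex.ofReal_inv,
    Complex.ofReal_re, Complex.ofReal_re, Real.log_inv]

theorem log_re_det_conjDiag {U : Matrix ι ι ℂ} (hU : U ∈ unitaryGroup ι ℂ) {d : ι → ℝ}
    (hd : ∀ i, 0 < d i) : Real.log (conjDiag U d).det.re = ∑ i, Real.log (d i) := by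
  rw [det_conjDiag hU, Complex.ofReal_re, Real.log_prod fun i _ => (hd i).ne']

-- The equality case of the AM-GM inequality for the eigenvalues.
theorem eq_one_of_re_trace_eq_card_of_one_le_re_det {M : Matrix ι ι ℂ} (hM : M.PosDef)
    (htrace : M.trace.re = card ι) (hdet : 1 ≤ M.det.re) : M = 1 := by
  obtain ⟨U, hU, d, hd, rfl⟩ := exists_eq_conjDiag hM
  have hlog : 0 ≤ ∑ i, Real.log (d i) := by
    rw [← log_re_det_conjDiag hU hd]
    exact Real.log_nonneg hdet
  rw [trace_conjDiag hU, Complex.ofReal_re] at htrace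
  have hsum : ∑ i, (d i - 1) = 0 := by simp [htrace]
  have hle (i : ι) : Real.log (d i) ≤ d i - 1 := Real.log_le_sub_one_of_pos (hd i)
  have heq := (Finset.sum_eq_sum_iff_of_le fun i (_ : i ∈ Finset.univ) => hle i).1
    (le_antisymm (Finset.sum_le_sum fun i _ => hle i) (hsum.trans_le hlog))
  have hone : d = 1 := by
    funext i
    by_contra hne
    exact (Real.log_lt_sub_one_of_pos (hd i) hne).ne (heq i (Finset.mem_univ i))
  rw [hone, conjDiag_one hU]

theorem eq_inv_of_re_trace_mul_eq_card {A H : Matrix ι ι ℂ} (hA : A.PosDef) (hH : H.PosDef)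
    (htrace : (H * A).trace.re = card ι) (hdet : 1 ≤ H.det.re * A.det.re) : A = H⁻¹ := by
  obtain ⟨B, hB, rfl⟩ := exists_isUnit_eq_conjTranspose_mul_self hA
  have hpos : (B * H * Bᴴ).PosDef :=
    hH.mul_mul_conjTranspose_same (vecMul_injective_of_isUnit hB)
  have hone : B * H * Bᴴ = 1 := by
    refine eq_one_of_re_trace_eq_card_of_one_le_re_det hpos ?_ ?_
    · rwa [mul_assoc, trace_mul_comm, mul_assoc]
    · have hdet' : (B * H * Bᴴ).det = H.det * (Bᴴ * B).det := by
        rw [det_mul, det_mul, det_mul]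
        ring
      rwa [hdet', ← ofReal_re_det hH, Complex.re_ofReal_mul]
  refine (inv_eq_right_inv ?_).symm
  rw [← mul_assoc, mul_eq_one_comm, ← mul_assoc, hone]

/-- The functional `H ↦ ∫ log ⟨H z, z⟩ - log det H / n` on positive definite matrices, the inverses
of whose minimisers are the fixed points of `frameMap μ z`. -/
def potential (μ : Measure X) (z : X → ι → ℂ) (H : Matrix ι ι ℂ) : ℝ :=
  ∫ x, Real.log (quadForm H (z x)) ∂μ - Real.log H.det.re / card ι

theorem conjDiag_smul (U : Matrix ι ι ℂ) (c : ℝ) (d : ι → ℝ) :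
    conjDiag U (c • d) = c • conjDiag U d := by
  have hdiag : (diagonal fun i => (((c • d) i : ℝ) : ℂ)) = c • diagonal fun i => (d i : ℂ) := by
    rw [← diagonal_smul]
    congr 1
    ext i
    simp
  rw [conjDiag, hdiag, mul_smul_comm, smul_mul_assoc, conjDiag]

/-- The set of Hermitian matrices with eigenvalues between `1` and `b`. -/
def spectralBox (ι : Type*) [Fintype ι] [DecidableEq ι] (b : ℝ) : Set (Matrix ι ι ℂ) :=
  (fun p : Matrix ι ι ℂ × (ι → ℝ) => conjDiag p.1 p.2) ''
    ((unitaryGroup ι ℂ : Set (Matrix ι ι ℂ)) ×ˢ Set.Icc 1 fun _ => b)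

theorem isCompact_spectralBox (b : ℝ) : IsCompact (spectralBox ι b) :=
  (isCompact_unitaryGroup.prod isCompact_Icc).image continuous_conjDiag

theorem one_mem_spectralBox {b : ℝ} (hb : 1 ≤ b) : 1 ∈ spectralBox ι b :=
  ⟨(1, 1), ⟨one_mem _, le_rfl, fun _ => hb⟩, conjDiag_one (one_mem _)⟩

theorem posDef_of_mem_spectralBox {b : ℝ} {H : Matrix ι ι ℂ} (hH : H ∈ spectralBox ι b) :
    H.PosDef := by
  obtain ⟨⟨U, d⟩, ⟨hU, hd⟩, rfl⟩ := hH
  exact posDef_conjDiag hU fun i => one_pos.trans_le (hd.1 i)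

theorem quadForm_mem_Icc_of_mem_spectralBox {b : ℝ} {H : Matrix ι ι ℂ} (hH : H ∈ spectralBox ι b)
    {v : ι → ℂ} (hv : ‖toLp 2 v‖ = 1) : quadForm H v ∈ Set.Icc 1 b := by
  obtain ⟨⟨U, d⟩, ⟨hU, hd⟩, rfl⟩ := hH
  have hsum := sum_norm_sq_conjTranspose_mulVec hU v
  rw [hv, one_pow] at hsum
  simp only [quadForm_conjDiag]
  constructor
  · rw [← hsum]
    exact Finset.sum_le_sum fun i _ => le_mul_of_one_le_left (sq_nonneg _) (hd.1 i)
  · rw [← mul_one b, ← hsum, Finset.mul_sum]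
    exact Finset.sum_le_sum fun i _ => mul_le_mul_of_nonneg_right (hd.2 i) (sq_nonneg _)

theorem exists_smul_mem_spectralBox_or_lt {b : ℝ} {U : Matrix ι ι ℂ} (hU : U ∈ unitaryGroup ι ℂ)
    {d : ι → ℝ} (hd : ∀ i, 0 < d i) [Nonempty ι] :
    (∃ c : ℝ, 0 < c ∧ c • conjDiag U d ∈ spectralBox ι b) ∨ ∃ p q, b < d p / d q := by
  obtain ⟨q, hq⟩ := Finite.exists_min d
  refine or_iff_not_imp_right.2 fun hnot => ?_
  push Not at hnot
  refine ⟨(d q)⁻¹, inv_pos.2 (hd q), (U, (d q)⁻¹ • d), ⟨hU, fun i => ?_, fun i => ?_⟩,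
    conjDiag_smul ..⟩
  · simpa [inv_mul_eq_div] using (one_le_div (hd q)).2 (hq i)
  · simpa [inv_mul_eq_div] using hnot i q

namespace UnitFrame

variable (hz : UnitFrame z)
include hz

theorem potential_one : potential μ z 1 = 0 := by
  simp [potential, hz.quadForm_one_eq_one]

theorem continuousOn_potential [IsFiniteMeasure μ] (b : ℝ) :
    ContinuousOn (potential μ z) (spectralBox ι b) := by
  have hmem {H : Matrix ι ι ℂ} (hH : H ∈ spectralBox ι b) (x : X) :=
    quadForm_mem_Icc_of_mem_spectralBox hH (hz.norm_eq_one x)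
  refine .sub (continuousOn_of_dominated (bound := fun _ => Real.log b) ?_ ?_
    (integrable_const _) ?_) (.div_const (.log ?_ fun H hH => ?_) _)
  · exact fun H _ => (Real.measurable_log.comp (hz.measurable_quadForm H)).aestronglyMeasurable
  · refine fun H hH => .of_forall fun x => ?_
    rw [Real.norm_of_nonneg (Real.log_nonneg (hmem hH x).1)]
    exact Real.log_le_log (one_pos.trans_le (hmem hH x).1) (hmem hH x).2
  · exact .of_forall fun x => (continuous_quadForm (z x)).continuousOn.log fun H hH =>
      (one_pos.trans_le (hmem hH x).1).ne'
  · exact (Complex.continuous_re.comp (continuous_id.matrix_det)).continuousOn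
  · exact (re_det_pos (posDef_of_mem_spectralBox hH)).ne'

theorem potential_smul [IsProbabilityMeasure μ] [Nonempty ι] {c : ℝ} (hc : 0 < c)
    {H : Matrix ι ι ℂ} (hH : H.PosDef) : potential μ z (c • H) = potential μ z H := by
  have hlog (x : X) : Real.log (quadForm (c • H) (z x)) =
      Real.log c + Real.log (quadForm H (z x)) := by
    rw [quadForm_smul, Real.log_mul hc.ne' (hz.quadForm_pos hH x).ne']
  have hdet : Real.log (c • H).det.re = card ι * Real.log c + Real.log H.det.re := by
    rw [det_smul_of_tower, Complex.smul_re, smul_eq_mul,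
      Real.log_mul (pow_pos hc _).ne' (re_det_pos hH).ne', Real.log_pow]
  simp only [potential, hlog, hdet]
  rw [integral_add (integrable_const _) (hz.integrable_log_quadForm hH), integral_const,
    probReal_univ, one_smul]
  field_simp
  ring

end UnitFrame

namespace StableFrame

variable [IsProbabilityMeasure μ] [Nonempty ι] (hz : StableFrame μ z)
include hz

theorem exists_smul_mem_spectralBox_or_potential_nonneg :
    ∃ b ≥ 1, ∀ H : Matrix ι ι ℂ, H.PosDef →
      (∃ c : ℝ, 0 < c ∧ c • H ∈ spectralBox ι b) ∨ 0 ≤ potential μ z H := by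
  obtain ⟨ε, hε, hε1, hstable⟩ := hz.exists_uniform_measure_columnMass_le
  have hexp : 0 ≤ -Real.log ε / ε :=
    div_nonneg (neg_nonneg.2 (Real.log_nonpos hε.le hε1)) hε.le
  refine ⟨Real.exp (-Real.log ε / ε), Real.one_le_exp hexp, fun H hH => ?_⟩
  obtain ⟨U, hU, d, hd, rfl⟩ := exists_eq_conjDiag hH
  refine (exists_smul_mem_spectralBox_or_lt hU hd).imp_right fun ⟨p, q, hpq⟩ => ?_
  have hlog : -Real.log ε / ε ≤ Real.log (d p) - Real.log (d q) := by
    rw [← Real.log_div (hd p).ne' (hd q).ne']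
    exact (Real.le_log_iff_exp_le (div_pos (hd p) (hd q))).2 hpq.le
  rw [div_le_iff₀' hε] at hlog
  have hle := hz.log_add_mean_add_mul_sub_le_integral_log hU hε hε1 (hstable U hU) hd p q
  rw [potential, log_re_det_conjDiag hU hd]
  linarith

theorem exists_potential_le :
    ∃ H : Matrix ι ι ℂ, H.PosDef ∧ ∀ H', H'.PosDef → potential μ z H ≤ potential μ z H' := by
  obtain ⟨b, hb, hcoercive⟩ := hz.exists_smul_mem_spectralBox_or_potential_nonneg
  obtain ⟨H, hH, hmin⟩ := (isCompact_spectralBox b).exists_isMinOn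
    ⟨1, one_mem_spectralBox hb⟩ (hz.continuousOn_potential (μ := μ) b)
  refine ⟨H, posDef_of_mem_spectralBox hH, fun H' hH' => ?_⟩
  rcases hcoercive H' hH' with ⟨c, hc, hmem⟩ | hnonneg
  · exact (hmin hmem).trans_eq (hz.potential_smul hc hH')
  · exact ((hmin (one_mem_spectralBox hb)).trans_eq hz.potential_one).trans hnonneg

theorem integral_log_quadForm_inv_frameMap_le {G : Matrix ι ι ℂ} (hG : G.PosDef) :
    ∫ x, Real.log (quadForm (frameMap μ z G)⁻¹ (z x)) ∂μ ≤
      ∫ x, Real.log (quadForm G⁻¹ (z x)) ∂μ := by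
  have hF := hz.posDef_frameMap hG
  have hratio : ∫ x, (quadForm G⁻¹ (z x))⁻¹ * quadForm (frameMap μ z G)⁻¹ (z x) ∂μ = 1 := by
    have htrace := hz.re_trace_mul_frameMap (μ := μ) hG (frameMap μ z G)⁻¹
    rw [nonsing_inv_mul _ ((isUnit_iff_isUnit_det _).1 hF.isUnit), trace_one,
      Complex.natCast_re] at htrace
    exact (mul_right_eq_self₀.1 htrace.symm).resolve_right (by positivity)
  have hint := hz.integrable_mul_quadForm (hz.integrable_inv_quadForm (μ := μ) hG.inv)
    (frameMap μ z G)⁻¹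
  have hpoint (x : X) :
      Real.log (quadForm (frameMap μ z G)⁻¹ (z x)) - Real.log (quadForm G⁻¹ (z x)) ≤
        (quadForm G⁻¹ (z x))⁻¹ * quadForm (frameMap μ z G)⁻¹ (z x) - 1 := by
    have hGx := hz.quadForm_pos hG.inv x
    have hFx := hz.quadForm_pos hF.inv x
    rw [← Real.log_div hFx.ne' hGx.ne', inv_mul_eq_div]
    exact Real.log_le_sub_one_of_pos (div_pos hFx hGx)
  have hlogF := hz.integrable_log_quadForm (μ := μ) hF.inv
  have hlogG := hz.integrable_log_quadForm (μ := μ) hG.inv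
  have hle := integral_mono (hlogF.sub hlogG) (hint.sub (integrable_const 1)) hpoint
  simp only [Pi.sub_apply] at hle
  rw [integral_sub hlogF hlogG, integral_sub hint (integrable_const _), hratio, integral_const,
    probReal_univ, one_smul] at hle
  linarith

theorem frameMap_eq_self_of_potential_inv_le {G : Matrix ι ι ℂ} (hG : G.PosDef)
    (hle : potential μ z G⁻¹ ≤ potential μ z (frameMap μ z G)⁻¹) : frameMap μ z G = G := by
  have hF := hz.posDef_frameMap hG
  have hGdet : IsUnit G.det := (isUnit_iff_isUnit_det _).1 hG.isUnit
  have htrace : (G⁻¹ * frameMap μ z G).trace.re = card ι := by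
    rw [hz.re_trace_mul_frameMap hG]
    simp [inv_mul_cancel₀ (hz.quadForm_pos hG.inv _).ne']
  have hdet : 1 ≤ G⁻¹.det.re * (frameMap μ z G).det.re := by
    have hpos := mul_pos (re_det_pos hG.inv) (re_det_pos hF)
    rw [← Real.log_nonneg_iff hpos,
      Real.log_mul (re_det_pos hG.inv).ne' (re_det_pos hF).ne']
    have hlog := hz.integral_log_quadForm_inv_frameMap_le hG
    rw [potential, potential, log_re_det_inv hF] at hle
    have hdiv : (-Real.log (frameMap μ z G).det.re) / card ι ≤ Real.log G⁻¹.det.re / card ι := by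
      linarith
    linarith [(div_le_div_iff_of_pos_right (by positivity)).1 hdiv]
  rw [eq_inv_of_re_trace_mul_eq_card hF hG.inv htrace hdet, nonsing_inv_nonsing_inv _ hGdet]

theorem exists_posDef_frameMap_eq_self : ∃ G : Matrix ι ι ℂ, G.PosDef ∧ frameMap μ z G = G := by
  obtain ⟨H, hH, hmin⟩ := hz.exists_potential_le
  have hHdet : IsUnit H.det := (isUnit_iff_isUnit_det _).1 hH.isUnit
  refine ⟨H⁻¹, hH.inv, hz.frameMap_eq_self_of_potential_inv_le hH.inv ?_⟩
  rw [nonsing_inv_nonsing_inv _ hHdet]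
  exact hmin _ (hz.posDef_frameMap hH.inv).inv

end StableFrame

/-! ### Change of coordinates -/

theorem frameMap_smul {c : ℝ} (hc : c ≠ 0) {G : Matrix ι ι ℂ} (hG : IsUnit G) :
    frameMap μ z (c • G) = c • frameMap μ z G := by
  have hinv : (c • G)⁻¹ = c⁻¹ • G⁻¹ := by
    refine inv_eq_left_inv ?_
    rw [smul_mul_smul_comm, inv_mul_cancel₀ hc,
      nonsing_inv_mul _ ((isUnit_iff_isUnit_det _).1 hG), one_smul]
  simp only [frameMap, hinv, quadForm_smul, mul_inv, inv_inv, frameOperator_const_mul]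

section

variable {R : Matrix ι ι ℂ} (hR : IsUnit R)
include hR

theorem mulVec_ne_zero {v : ι → ℂ} (hv : v ≠ 0) : R *ᵥ v ≠ 0 := fun hzero =>
  hv (mulVec_injective_of_isUnit hR (hzero.trans (mulVec_zero R).symm))

theorem inv_mul_mul_mul_conjTranspose_mul_inv (M : Matrix ι ι ℂ) :
    R⁻¹ * (R * M * Rᴴ) * Rᴴ⁻¹ = M := by
  have hR' : IsUnit Rᴴ := hR.star
  rw [isUnit_iff_isUnit_det] at hR hR'
  rw [← mul_assoc, ← mul_assoc, nonsing_inv_mul _ hR, one_mul, mul_assoc, mul_nonsing_inv _ hR',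
    mul_one]

theorem conjTranspose_mul_inv_mul (G : Matrix ι ι ℂ) : Rᴴ * (R * G * Rᴴ)⁻¹ * R = G⁻¹ := by
  have hR' : IsUnit Rᴴ := hR.star
  rw [isUnit_iff_isUnit_det] at hR hR'
  rw [Matrix.mul_inv_rev, Matrix.mul_inv_rev, ← mul_assoc, mul_nonsing_inv _ hR', one_mul,
    mul_assoc, nonsing_inv_mul _ hR, mul_one]

theorem UnitFrame.unitVec_mulVec (hz : UnitFrame z) :
    UnitFrame fun x => unitVec (R *ᵥ z x) where
  stronglyMeasurable_outer := by
    simp only [outer_unitVec, outer_mulVec, ← quadForm_conjTranspose_mul_self]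
    have hconj : Continuous fun M : Matrix ι ι ℂ => R * M * Rᴴ := by fun_prop
    exact (hz.measurable_quadForm _).inv.stronglyMeasurable.smul
      (hconj.comp_stronglyMeasurable hz.stronglyMeasurable_outer)
  norm_eq_one x := norm_unitVec (mulVec_ne_zero hR (hz.ne_zero x))

theorem StableFrame.unitVec_mulVec (hz : StableFrame μ z) :
    StableFrame μ fun x => unitVec (R *ᵥ z x) where
  toUnitFrame := hz.toUnitFrame.unitVec_mulVec hR
  measure_mem_lt W hbot htop := by
    let e : (ι → ℂ) ≃ₗ[ℂ] (ι → ℂ) :=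
      LinearEquiv.ofInjectiveEndo (mulVecLin R) (mulVec_injective_of_isUnit hR)
    have hmap : (W.comap e.toLinearMap).map e.toLinearMap = W :=
      Submodule.map_comap_eq_of_surjective e.surjective W
    have hlt := hz.measure_mem_lt (W.comap e.toLinearMap)
      (fun hcomap => hbot (by rw [← hmap, hcomap, Submodule.map_bot]))
      (fun hcomap => htop (by rw [← hmap, hcomap, Submodule.map_top, e.range]))
    have hrank : finrank ℂ (W.comap e.toLinearMap) = finrank ℂ W := by
      rw [← LinearEquiv.finrank_map_eq e, hmap]
    rw [hrank] at hlt
    simp only [unitVec_mem_iff (mulVec_ne_zero hR (hz.ne_zero _))]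
    exact hlt

theorem UnitFrame.frameMap_unitVec_mulVec [IsFiniteMeasure μ] (hz : UnitFrame z)
    {G : Matrix ι ι ℂ} (hG : G.PosDef) :
    frameMap μ (fun x => unitVec (R *ᵥ z x)) (R * G * Rᴴ) = R * frameMap μ z G * Rᴴ := by
  have hpoint (x : X) : (quadForm (R * G * Rᴴ)⁻¹ (unitVec (R *ᵥ z x)))⁻¹ •
      outer (unitVec (R *ᵥ z x)) = R * ((quadForm G⁻¹ (z x))⁻¹ • outer (z x)) * Rᴴ := by
    have hnorm : ‖toLp 2 (R *ᵥ z x)‖ ^ 2 ≠ 0 := by simpa using mulVec_ne_zero hR (hz.ne_zero x)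
    rw [quadForm_unitVec, outer_unitVec, ← quadForm_conj, conjTranspose_mul_inv_mul hR,
      outer_mulVec, smul_smul, mul_inv, inv_inv, mul_right_comm, mul_inv_cancel₀ hnorm, one_mul,
      mul_smul_comm, smul_mul_assoc]
  let conj : Matrix ι ι ℂ →ₗ[ℝ] Matrix ι ι ℂ :=
    LinearMap.mulRight ℝ Rᴴ ∘ₗ LinearMap.mulLeft ℝ R
  have hcomm := (LinearMap.toContinuousLinearMap conj).integral_comp_comm
    (hz.integrable_smul_outer (hz.integrable_inv_quadForm (μ := μ) hG.inv))
  simp only [frameMap, frameOperator, hpoint]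
  rw [mul_smul_comm, smul_mul_assoc]
  exact congrArg _ hcomm

theorem StableFrame.iterate_frameMap_unitVec_mulVec [IsProbabilityMeasure μ] [Nonempty ι]
    (hz : StableFrame μ z) {G : Matrix ι ι ℂ} (hG : G.PosDef) (r : ℕ) :
    (frameMap μ fun x => unitVec (R *ᵥ z x))^[r] (R * G * Rᴴ) =
      R * (frameMap μ z)^[r] G * Rᴴ := by
  induction r with
  | zero => rfl
  | succ r ih =>
    rw [Function.iterate_succ_apply', ih,
      hz.frameMap_unitVec_mulVec hR (hz.posDef_iterate_frameMap hG r),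
      Function.iterate_succ_apply']

end

theorem StableFrame.exists_dist_iterate_frameMap_le [IsProbabilityMeasure μ] [Nonempty ι]
    (hz : StableFrame μ z) {G₀ : Matrix ι ι ℂ} (hG₀ : G₀.PosDef) :
    ∃ G : Matrix ι ι ℂ, G.PosDef ∧ frameMap μ z G = G ∧ ∃ C β : ℝ, 0 < C ∧ 0 < β ∧ β < 1 ∧
      ∀ r : ℕ, dist ((frameMap μ z)^[r] G₀) G ≤ C * β ^ r := by
  obtain ⟨G, hG, hfix⟩ := hz.exists_posDef_frameMap_eq_self
  obtain ⟨R, hR, hRG⟩ := exists_isUnit_eq_conjTranspose_mul_self hG.inv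
  have hone : R * G * Rᴴ = 1 := by
    rw [mul_eq_one_comm, ← mul_assoc, ← hRG,
      nonsing_inv_mul _ ((isUnit_iff_isUnit_det _).1 hG.isUnit)]
  have hz' := hz.unitVec_mulVec hR
  have hbalanced : frameOperator μ (fun x => unitVec (R *ᵥ z x)) 1 = 1 := by
    rw [← hz'.frameMap_one, ← hone, hz.frameMap_unitVec_mulVec hR hG, hfix]
  obtain ⟨c, C, γ, hc, hC, hγ, hγ1, hle⟩ := hz'.exists_norm_iterate_sub_smul_one_le
    (hG₀.mul_mul_conjTranspose_same (vecMul_injective_of_isUnit hR)) hbalanced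
  refine ⟨c • G, hG.smul hc, by rw [frameMap_smul hc.ne' hG.isUnit, hfix],
    (‖R⁻¹‖ * ‖Rᴴ⁻¹‖ + 1) * C, γ, by positivity, hγ, hγ1, fun r => ?_⟩
  have hback : (frameMap μ z)^[r] G₀ - c • G =
      R⁻¹ * ((frameMap μ fun x => unitVec (R *ᵥ z x))^[r] (R * G₀ * Rᴴ) - c • 1) * Rᴴ⁻¹ := by
    rw [hz.iterate_frameMap_unitVec_mulVec hR hG₀, ← hone, ← smul_mul_assoc, ← mul_smul_comm,
      ← sub_mul, ← mul_sub, inv_mul_mul_mul_conjTranspose_mul_inv hR]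
  set E := (frameMap μ fun x => unitVec (R *ᵥ z x))^[r] (R * G₀ * Rᴴ) - c • 1
  calc dist ((frameMap μ z)^[r] G₀) (c • G) = ‖R⁻¹ * E * Rᴴ⁻¹‖ := by rw [dist_eq_norm, hback]
    _ ≤ ‖R⁻¹‖ * ‖E‖ * ‖Rᴴ⁻¹‖ := (frobenius_norm_mul _ _).trans
        (mul_le_mul_of_nonneg_right (frobenius_norm_mul _ _) (norm_nonneg _))
    _ = ‖R⁻¹‖ * ‖Rᴴ⁻¹‖ * ‖E‖ := by ring
    _ ≤ (‖R⁻¹‖ * ‖Rᴴ⁻¹‖ + 1) * (C * γ ^ r) := by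
        gcongr
        exacts [le_add_of_nonneg_right zero_le_one, hle r]
    _ = (‖R⁻¹‖ * ‖Rᴴ⁻¹‖ + 1) * C * γ ^ r := by ring

/-! ### Projective space -/

variable {n : ℕ}

theorem herm_eq_star_dotProduct (v w : Fin n → ℂ) : herm v w = star w ⬝ᵥ v :=
  dotProduct_comm v (star w)

theorem herm_mulVec_self {A : Matrix (Fin n) (Fin n) ℂ} (hA : A.IsHermitian) (v : Fin n → ℂ) :
    herm (A *ᵥ v) v = (quadForm A v : ℂ) := by
  rw [herm_eq_star_dotProduct, star_dotProduct_mulVec_eq_quadForm hA]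

theorem herm_self (v : Fin n → ℂ) : herm v v = ((‖toLp 2 v‖ ^ 2 : ℝ) : ℂ) := by
  simpa [quadForm_one] using herm_mulVec_self isHermitian_one v

theorem outer_unitVec_eq_lineProj (v : Fin n → ℂ) : outer (unitVec v) = lineProj v := by
  ext i j
  rw [outer_unitVec, lineProj, of_apply, herm_self, Matrix.smul_apply, outer, vecMulVec_apply,
    Pi.star_apply, Complex.real_smul, Complex.ofReal_inv, inv_mul_eq_div]

theorem lineProj_smul {a : ℂ} (ha : a ≠ 0) (v : Fin n → ℂ) : lineProj (a • v) = lineProj v := by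
  have haa : a * star a ≠ 0 := mul_ne_zero ha (star_ne_zero.2 ha)
  have hherm : herm (a • v) (a • v) = a * star a * herm v v := by
    simp only [herm_eq_star_dotProduct, star_smul, smul_dotProduct, dotProduct_smul, smul_eq_mul]
    ring
  ext i j
  rw [lineProj, lineProj, of_apply, of_apply, hherm, Pi.smul_apply, Pi.smul_apply, smul_eq_mul,
    smul_eq_mul, star_mul', mul_mul_mul_comm, mul_div_mul_left _ _ haa]

theorem continuous_lineProj_rep : Continuous fun x : CProj n => lineProj x.rep := by
  have hquot : IsQuotientMap (Quotient.mk (projectivizationSetoid ℂ (Fin n → ℂ))) :=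
    isQuotientMap_quotient_mk'
  have hrep (v : {v : Fin n → ℂ // v ≠ 0}) :
      lineProj (Projectivization.mk ℂ v.1 v.2).rep = lineProj v.1 := by
    obtain ⟨a, ha⟩ := Projectivization.exists_smul_eq_mk_rep ℂ v.1 v.2
    rw [← ha, Units.smul_def, lineProj_smul a.ne_zero]
  have hcont : Continuous fun v : {v : Fin n → ℂ // v ≠ 0} => lineProj v.1 := by
    simp only [← outer_unitVec_eq_lineProj, outer_unitVec]
    have houter : Continuous (outer (ι := Fin n)) := by
      unfold outer
      fun_prop
    have hnorm : Continuous fun v : {v : Fin n → ℂ // v ≠ 0} => ‖toLp 2 v.1‖ ^ 2 := by fun_prop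
    exact (hnorm.inv₀ fun v => by simpa using v.2).smul (houter.comp continuous_subtype_val)
  exact hquot.continuous_iff.2 (hcont.congr fun v => (hrep v).symm)

theorem unitFrame_unitVec_rep : UnitFrame fun x : CProj n => unitVec x.rep where
  stronglyMeasurable_outer := by
    simpa only [outer_unitVec_eq_lineProj] using continuous_lineProj_rep.stronglyMeasurable
  norm_eq_one x := norm_unitVec x.rep_nonzero

theorem unitVec_rep_mem_iff (W : Submodule ℂ (Fin n → ℂ)) (x : CProj n) :
    unitVec x.rep ∈ W ↔ x ∈ W.projectivization := by
  rw [unitVec_mem_iff x.rep_nonzero]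
  conv_rhs => rw [← x.mk_rep]
  rw [Submodule.mk_mem_projectivization_iff]

theorem nonempty_fin_of_nonempty_cproj [Nonempty (CProj n)] : Nonempty (Fin n) := by
  obtain ⟨x⟩ := ‹Nonempty (CProj n)›
  obtain ⟨i, -⟩ := Function.ne_iff.1 x.rep_nonzero
  exact ⟨i⟩

theorem stableFrame_unitVec_rep {ν : Measure (CProj n)} [IsFiniteMeasure ν] [NeZero ν]
    (hi : ∀ L : Projectivization.Subspace ℂ (Fin n → ℂ), L ≠ ⊥ → L ≠ ⊤ →
      ν.real (L : Set (CProj n)) / (finrank ℂ (Projectivization.Subspace.submodule L) : ℝ) <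
        ν.real Set.univ / (n : ℝ)) :
    StableFrame ((ν Set.univ)⁻¹ • ν) fun x => unitVec x.rep where
  toUnitFrame := unitFrame_unitVec_rep
  measure_mem_lt W hbot htop := by
    have : Nonempty (CProj n) := Measure.nonempty_of_neZero ν
    have : Nonempty (Fin n) := nonempty_fin_of_nonempty_cproj
    have hlt := hi W.projectivization (by simpa using hbot) (by simpa using htop)
    have hset : {x : CProj n | unitVec x.rep ∈ W} = (W.projectivization : Set (CProj n)) :=
      Set.ext (unitVec_rep_mem_iff W)
    have hsub : Projectivization.Subspace.submodule W.projectivization = W :=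
      OrderIso.apply_symm_apply _ _
    have hrank : (0 : ℝ) < finrank ℂ W :=
      Nat.cast_pos.2 (Nat.pos_of_ne_zero fun hzero => hbot (Submodule.finrank_eq_zero.1 hzero))
    have hn : (0 : ℝ) < n := Nat.cast_pos.2 (Fin.pos_iff_nonempty.2 ‹_›)
    have hmass : 0 < ν.real Set.univ := measureReal_univ_pos
    rw [hsub, div_lt_div_iff₀ hrank hn] at hlt
    rw [hset, measureReal_ennreal_smul_apply, ENNReal.toReal_inv, ← measureReal_def,
      inv_mul_eq_div, Fintype.card_fin, div_lt_div_iff₀ hmass hn]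
    linarith

theorem T_eq_frameMap (ν : Measure (CProj n)) {G : Matrix (Fin n) (Fin n) ℂ} (hG : G.PosDef) :
    T ν G = frameMap ((ν Set.univ)⁻¹ • ν) (fun x => unitVec x.rep) G := by
  have hpoint (x : CProj n) :
      (herm x.rep x.rep / herm (G⁻¹ *ᵥ x.rep) x.rep) • lineProj x.rep =
        (quadForm G⁻¹ (unitVec x.rep))⁻¹ • outer (unitVec x.rep) := by
    rw [herm_self, herm_mulVec_self hG.inv.1, ← Complex.ofReal_div, outer_unitVec_eq_lineProj,
      quadForm_unitVec, mul_inv, inv_inv, ← div_eq_mul_inv]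
    rfl
  rw [T, frameMap, frameOperator, integral_smul_measure, ENNReal.toReal_inv, ← measureReal_def,
    smul_smul, div_eq_mul_inv, Fintype.card_fin]
  simp only [hpoint]

theorem iterate_T_eq_iterate_frameMap {ν : Measure (CProj n)} [IsFiniteMeasure ν] [NeZero ν]
    [Nonempty (Fin n)] (hz : StableFrame ((ν Set.univ)⁻¹ • ν) fun x => unitVec x.rep)
    {G : Matrix (Fin n) (Fin n) ℂ} (hG : G.PosDef) (r : ℕ) :
    (T ν)^[r] G = (frameMap ((ν Set.univ)⁻¹ • ν) fun x => unitVec x.rep)^[r] G := by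
  induction r with
  | zero => rfl
  | succ r ih =>
    rw [Function.iterate_succ_apply', Function.iterate_succ_apply', ih,
      T_eq_frameMap ν (hz.posDef_iterate_frameMap hG r)]

end Donaldson

end

theorem corollary4p8_general {n : ℕ} (ν : Measure (Donaldson.CProj n)) [IsFiniteMeasure ν]
    (hν : ν ≠ 0)
    (hi : ∀ L : Projectivization.Subspace ℂ (Fin n → ℂ), L ≠ ⊥ → L ≠ ⊤ →
      ν.real (L : Set (Donaldson.CProj n)) /
          (Module.finrank ℂ (Projectivization.Subspace.submodule L) : ℝ)
        < ν.real Set.univ / (n : ℝ))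
    (G₀ : Matrix (Fin n) (Fin n) ℂ) (hG₀ : G₀.PosDef) :
    (∀ r : ℕ, ((Donaldson.T ν)^[r] G₀).PosDef) ∧
    ∃ Ginf : Matrix (Fin n) (Fin n) ℂ, Ginf.PosDef ∧ Donaldson.T ν Ginf = Ginf ∧
      ∃ C β : ℝ, 0 < C ∧ 0 < β ∧ β < 1 ∧
        ∀ r : ℕ, dist ((Donaldson.T ν)^[r] G₀) Ginf ≤ C * β ^ r := by
  have : NeZero ν := ⟨hν⟩
  have : Nonempty (Donaldson.CProj n) := Measure.nonempty_of_neZero ν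
  have : Nonempty (Fin n) := Donaldson.nonempty_fin_of_nonempty_cproj
  have hstable := Donaldson.stableFrame_unitVec_rep hi
  obtain ⟨G, hG, hfix, hconv⟩ := hstable.exists_dist_iterate_frameMap_le hG₀
  simp only [Donaldson.iterate_T_eq_iterate_frameMap hstable hG₀]
  exact ⟨hstable.posDef_iterate_frameMap hG₀,
    G, hG, (Donaldson.T_eq_frameMap ν hG).trans hfix, hconv⟩

theorem corollary4p8 {n : ℕ} (ν : Measure (Donaldson.CProj n)) [IsFiniteMeasure ν] (hν : ν ≠ 0)
    -- `ν` is supported on a complex variety `Y` and absolutely continuous on its components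
    (Y : Set (Donaldson.CProj n)) (hY : Donaldson.IsVariety Y) (hsupp : ν Yᶜ = 0)
    (hac : ∀ Z, Donaldson.IsComponent Y Z → Donaldson.AbsContOn ν Z)
    -- (i), for all non-empty proper projective subspaces; `finrank` is `dim L + 1`
    (hi : ∀ L : Projectivization.Subspace ℂ (Fin n → ℂ), L ≠ ⊥ → L ≠ ⊤ →
      ν.real (L : Set (Donaldson.CProj n)) /
          (Module.finrank ℂ (Projectivization.Subspace.submodule L) : ℝ)
        < ν.real Set.univ / (n : ℝ))
    -- (ii)
    (hii : ∃ Z, Donaldson.IsComponent Y Z ∧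
      ∀ L : Projectivization.Subspace ℂ (Fin n → ℂ), Z ⊆ (L : Set (Donaldson.CProj n)) → L = ⊤)
    (G₀ : Matrix (Fin n) (Fin n) ℂ) (hG₀ : G₀.PosDef) :
    (∀ r : ℕ, ((Donaldson.T ν)^[r] G₀).PosDef) ∧
    ∃ Ginf : Matrix (Fin n) (Fin n) ℂ, Ginf.PosDef ∧ Donaldson.T ν Ginf = Ginf ∧
      ∃ C β : ℝ, 0 < C ∧ 0 < β ∧ β < 1 ∧
        ∀ r : ℕ, dist ((Donaldson.T ν)^[r] G₀) Ginf ≤ C * β ^ r :=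
  corollary4p8_general ν hν hi G₀ hG₀
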